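/- A \emph{disc triangulation} is a finite simple plane graph $T$ whose outer face is bounded by a simple cycle (the boundary) and all of whose other faces are triangles; plane graphs are described combinatorially, by a connected graph with a cyclic order of the edges around each vertex (a rotation system) satisfying Euler's formula $|V|-|E|+|F|=2$, with one distinguished face as the outer face. A vertex of $T$ is \emph{internal} if it does not lie on the boundary cycle, and $d_T$ denotes the graph distance in $T$. \textbf{Lemma.} Let $T$ be a disc triangulation in which every internal vertex has degree at least $6$. Let $a,b,c$ be the vertices of a triangle in $T$ (that is, three pairwise adjacent vertices), and let $x$ be any vertex of $T$. Then the distances $d_T(x,a)$, $d_T(x,b)$, $d_T(x,c)$ are not all equal. -/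

import Mathlib

/-- A rotation system on a simple graph: a permutation of the darts (oriented edges) whose cycles
are exactly the sets of darts leaving a given vertex. It records, for each vertex, the cyclic
order in which the edges at that vertex appear around it in a drawing on an oriented surface. -/
structure RotationSystem {V : Type*} (G : SimpleGraph V) where
  /-- the next dart in the cyclic order around the initial vertex -/
  rot : Equiv.Perm G.Dart
  fst_rot : ∀ d : G.Dart, (rot d).fst = d.fst
  sameCycle_rot : ∀ d e : G.Dart, d.fst = e.fst → rot.SameCycle d e

namespace RotationSystem

variable {V : Type*} {G : SimpleGraph V}

/-- The face permutation: traverse a dart `u → v`, then leave `v` along the dart that follows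
`v → u` in the rotation at `v`. Its cycles are the boundary walks of the faces. -/
def facePerm (R : RotationSystem G) : Equiv.Perm G.Dart :=
  (SimpleGraph.Dart.symm_involutive (G := G)).toPerm.trans R.rot

/-- The faces of the embedded graph, as cycles of the face permutation. -/
def Face (R : RotationSystem G) : Type _ :=
  Quotient (Equiv.Perm.SameCycle.setoid R.facePerm)

/-- The darts on the boundary walk of a face; their number is the length of the face. -/
def faceDarts (R : RotationSystem G) (f : R.Face) : Set G.Dart :=
  {d | Quotient.mk (Equiv.Perm.SameCycle.setoid R.facePerm) d = f}

/-- The rotation system of a connected graph describes an embedding in the sphere: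
Euler's formula `|V| - |E| + |F| = 2` holds. -/
def IsPlanar (R : RotationSystem G) : Prop :=
  G.Connected ∧ (Nat.card V : ℤ) - (Nat.card G.edgeSet : ℤ) + (Nat.card R.Face : ℤ) = 2

end RotationSystem

/-- A disc triangulation with underlying graph `G`: a plane graph (a planar rotation system
together with a choice of the outer face) whose outer face is bounded by a simple cycle and all of
whose other faces are triangles. -/
structure DiscTriangulation {V : Type*} (G : SimpleGraph V) extends RotationSystem G where
  isPlanar : toRotationSystem.IsPlanar
  /-- the outer (unbounded) face -/
  outer : toRotationSystem.Face
  /-- the boundary walk of the outer face visits no vertex twice -/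
  outer_simple : Set.InjOn (fun d : G.Dart => d.fst) (toRotationSystem.faceDarts outer)
  /-- the boundary walk is a cycle, not a single edge traversed back and forth -/
  three_le_outer : 3 ≤ (toRotationSystem.faceDarts outer).ncard
  internal_triangle : ∀ f : toRotationSystem.Face, f ≠ outer →
    (toRotationSystem.faceDarts f).ncard = 3

/-- A vertex is internal if it does not lie on the boundary cycle. -/
def DiscTriangulation.IsInternal {V : Type*} {G : SimpleGraph V} (T : DiscTriangulation G)
    (v : V) : Prop :=
  ∀ d ∈ T.faceDarts T.outer, d.fst ≠ v

/-! The proof is a discrete Gauss–Bonnet argument. For a region of triangles, let a vertex on it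
carry `6 - corners - 3 * sectors`; the sum over vertices is six times the Euler characteristic `V -
E + F` of the region, hence at least `6` for the region enclosed by an edge set
(`six_le_sum_curvature`). A surrounded vertex is internal and contributes at most `0` by the degree
hypothesis. A boundary vertex contributes a positive amount only if one or two triangles of the
region meet it, namely at most `2` or `1` (`curvature_trichotomy`).

Apply this to two geodesics from `x` whose ends are equal or adjacent. An inner vertex of a side
contributes at most `1`, and if it contributes `1` the side can be pushed across two triangles,
which shrinks the region (`curvature_inner`). Once no push is possible, the few remaining corners
must supply all of `6`, so each attains its maximum. This yields three facts: adjacent vertices of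
one sphere have a common neighbour one step lower (`exists_common_lower_neighbor`); two lower
neighbours of a vertex are adjacent (`adj_of_lower_neighbors`); every 3-cycle is an internal face,
so there is no `K₄` (`no_complete_four`).

An equidistant triangle at distance `n + 1` then gives one at distance `n`: the lower neighbours of
its three sides are distinct, for lack of `K₄`, and pairwise adjacent. The descent ends at distance
`0`.

Jordan separation and the Euler inequality for regions come from linear algebra: vertex differences
and face differences are orthogonal functions on darts, and Euler's formula makes them fill the
whole space. -/

namespace RotationSystem

open scoped Classical

/-! ### Combinatorics of the rotation and of the faces -/

section Basic

variable {V : Type*} {G : SimpleGraph V} (R : RotationSystem G)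

/-- The face whose boundary walk contains a given dart. -/
def face (d : G.Dart) : R.Face := Quotient.mk (Equiv.Perm.SameCycle.setoid R.facePerm) d

lemma face_surjective : Function.Surjective R.face := Quotient.mk_surjective

lemma mem_faceDarts {f : R.Face} {d : G.Dart} : d ∈ R.faceDarts f ↔ R.face d = f := Iff.rfl

lemma face_eq_face_iff {d e : G.Dart} : R.face d = R.face e ↔ R.facePerm.SameCycle d e :=
  Quotient.eq (r := Equiv.Perm.SameCycle.setoid R.facePerm)

lemma facePerm_apply (d : G.Dart) : R.facePerm d = R.rot d.symm := rfl

@[simp] lemma face_facePerm (d : G.Dart) : R.face (R.facePerm d) = R.face d :=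
  R.face_eq_face_iff.2 (Equiv.Perm.sameCycle_apply_left.2 (Equiv.Perm.SameCycle.refl _ _))

@[simp] lemma facePerm_fst (d : G.Dart) : (R.facePerm d).fst = d.snd := R.fst_rot _

lemma face_rot (d : G.Dart) : R.face (R.rot d) = R.face d.symm := by
  rw [← R.face_facePerm d.symm, facePerm_apply, SimpleGraph.Dart.symm_symm]

lemma fst_rot_symm (d : G.Dart) : (R.rot.symm d).fst = d.fst := by
  rw [← R.fst_rot, Equiv.apply_symm_apply]

lemma face_symm_rot_symm (d : G.Dart) : R.face (R.rot.symm d).symm = R.face d := by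
  rw [← R.face_rot, Equiv.apply_symm_apply]

/-- In a triangular face, the third side at the corner of `d` joins the ends of `d` and of the
dart preceding `d` in the rotation. -/
lemma snd_facePerm_of_ncard_eq_three {d : G.Dart} [Finite G.Dart]
    (h : (R.faceDarts (R.face d)).ncard = 3) :
    (R.facePerm d).snd = (R.rot.symm d).snd := by
  -- The face is the cycle of `d` under `facePerm`, and the order of a cycle is the size of its
  -- support.
  have key : (R.facePerm ^ 3) d = d := by
    have := Fintype.ofFinite G.Dart
    by_cases hd : R.facePerm d = d
    · simp [pow_succ, hd]
    have hs : R.faceDarts (R.face d) = ((R.facePerm.cycleOf d).support : Set G.Dart) := by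
      ext e
      rw [mem_faceDarts, face_eq_face_iff, Finset.mem_coe, Equiv.Perm.mem_support_cycleOf_iff' hd,
        Equiv.Perm.sameCycle_comm]
    rw [hs, Set.ncard_coe_finset, ← (Equiv.Perm.isCycle_cycleOf _ hd).orderOf] at h
    rw [← Equiv.Perm.cycleOf_pow_apply_self, ← h, pow_orderOf_eq_one, Equiv.Perm.one_apply]
  have h2 : R.rot (R.facePerm (R.facePerm d)).symm = d := by
    rw [← facePerm_apply]
    simpa [pow_succ] using key
  have h3 : R.rot.symm d = (R.facePerm (R.facePerm d)).symm := by
    rw [Equiv.symm_apply_eq, h2]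
  rw [h3]
  exact (R.facePerm_fst _).symm

/-- A property of darts invariant under reversal and rotation holds for all darts of a connected
graph as soon as it holds for one. -/
lemma dart_induction (hG : G.Connected) {P : G.Dart → Prop} (hsymm : ∀ d, P d → P d.symm)
    (hrot : ∀ d e : G.Dart, d.fst = e.fst → P d → P e) {d₀ : G.Dart} (h₀ : P d₀) (d : G.Dart) :
    P d := by
  have key : ∀ (u v : V), G.Walk u v → (∀ e : G.Dart, e.fst = u → P e) →
      ∀ e : G.Dart, e.fst = v → P e := by
    intro u v w
    induction w with
    | nil => exact fun h => h
    | cons hadj _ ih =>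
      intro h
      refine ih fun e he => hrot (SimpleGraph.Dart.symm ⟨(_, _), hadj⟩) e he.symm (hsymm _ ?_)
      exact h _ rfl
  obtain ⟨w⟩ := hG.preconnected d₀.fst d.fst
  exact key _ _ w (fun e he => hrot d₀ e he.symm h₀) d rfl

/-- A property of darts preserved by the rotation holds for all darts at a vertex as soon as it
holds for one. -/
lemma rot_induction [Finite G.Dart] {P : G.Dart → Prop} {d e : G.Dart}
    (hP : ∀ a : G.Dart, a.fst = d.fst → P a → P (R.rot a)) (h : d.fst = e.fst) (hd : P d) :
    P e := by
  obtain ⟨n, rfl⟩ := (R.sameCycle_rot d e h).exists_nat_pow_eq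
  have key : ∀ n, ((R.rot ^ n) d).fst = d.fst ∧ P ((R.rot ^ n) d) := by
    intro n
    induction n with
    | zero => exact ⟨rfl, hd⟩
    | succ n ih =>
      rw [pow_succ', Equiv.Perm.mul_apply, R.fst_rot]
      exact ⟨ih.1, hP _ ih.1 ih.2⟩
  exact (key n).2

/-- Connectedness of the dual graph: consecutive faces around a vertex share an edge, and the graph
itself is connected. -/
lemma face_function_const [Finite G.Dart] (hG : G.Connected) {α : Type*} (g : R.Face → α)
    (hg : ∀ d : G.Dart, g (R.face d) = g (R.face d.symm)) (f₁ f₂ : R.Face) : g f₁ = g f₂ := by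
  obtain ⟨d₁, rfl⟩ := R.face_surjective f₁
  obtain ⟨d₂, rfl⟩ := R.face_surjective f₂
  refine (dart_induction hG (P := fun d => g (R.face d) = g (R.face d₁)) ?_ ?_ rfl d₂).symm
  · intro d h
    rw [← hg, h]
  · intro d e h h'
    exact R.rot_induction (P := fun d => g (R.face d) = g (R.face d₁))
      (fun a _ ha => by rwa [face_rot, ← hg]) h h'

end Basic

/-! ### Discrete Hodge decomposition on darts -/

section LinearAlgebra

/-- The difference of a vertex function along darts. -/
def coboundary {V : Type*} (G : SimpleGraph V) : (V → ℝ) →ₗ[ℝ] (G.Dart → ℝ) :=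
  LinearMap.funLeft ℝ ℝ (fun d : G.Dart => d.snd) - LinearMap.funLeft ℝ ℝ (fun d : G.Dart => d.fst)

/-- The difference of a face function across darts. -/
def faceDiff {V : Type*} {G : SimpleGraph V} (R : RotationSystem G) :
    (R.Face → ℝ) →ₗ[ℝ] (G.Dart → ℝ) :=
  LinearMap.funLeft ℝ ℝ R.face - LinearMap.funLeft ℝ ℝ (fun d : G.Dart => R.face d.symm)

lemma coboundary_apply {V : Type*} {G : SimpleGraph V} (f : V → ℝ) (d : G.Dart) :
    coboundary G f d = f d.snd - f d.fst := rfl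

lemma coboundary_symm {V : Type*} {G : SimpleGraph V} (f : V → ℝ) (d : G.Dart) :
    coboundary G f d.symm = - coboundary G f d := by
  simp only [coboundary_apply]
  exact (neg_sub _ _).symm

lemma eq_of_coboundary_eq_zero {V : Type*} {G : SimpleGraph V} (hG : G.Connected) {f : V → ℝ}
    (h : ∀ d, coboundary G f d = 0) (u v : V) : f u = f v := by
  obtain ⟨w⟩ := hG.preconnected u v
  induction w with
  | nil => rfl
  | cons hadj _ ih => exact (sub_eq_zero.1 (h ⟨(_, _), hadj⟩)).symm.trans ih

/-- Multiplication by `σ` exchanges antisymmetric and symmetric dart functions, so two copies of the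
antisymmetric ones fit into the space of all dart functions. Dimensions can then be counted with
darts, without orienting edges. -/
lemma exists_antisymmetric_sign {V : Type*} [Finite V] (G : SimpleGraph V) :
    ∃ σ : G.Dart → ℝ, ∀ d, σ d ≠ 0 ∧ σ d.symm = - σ d := by
  obtain ⟨n, ⟨e⟩⟩ := Finite.exists_equiv_fin V
  refine ⟨fun d => (e d.snd : ℝ) - (e d.fst : ℝ), fun d => ⟨?_, (neg_sub _ _).symm⟩⟩
  rw [sub_ne_zero]
  intro h
  exact d.adj.ne' (e.injective (Fin.ext (by exact_mod_cast h)))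

variable {V : Type*} {G : SimpleGraph V} (R : RotationSystem G)

lemma faceDiff_apply (g : R.Face → ℝ) (d : G.Dart) :
    R.faceDiff g d = g (R.face d) - g (R.face d.symm) := rfl

lemma faceDiff_symm (g : R.Face → ℝ) (d : G.Dart) :
    R.faceDiff g d.symm = - R.faceDiff g d := by
  simp only [faceDiff_apply, SimpleGraph.Dart.symm_symm, neg_sub]

/-- Combine vertex functions supported on `A` and face functions supported on `C`, an
antisymmetric pair and, multiplied by `σ`, a symmetric pair, into a function on the darts
in `D`. -/
noncomputable def hodgeMap (σ : G.Dart → ℝ) (A : Finset V) (C : Finset R.Face)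
    (D : Finset G.Dart) :
    (((A → ℝ) × (C → ℝ)) × ((A → ℝ) × (C → ℝ))) →ₗ[ℝ] (D → ℝ) :=
  let M : ((A → ℝ) × (C → ℝ)) →ₗ[ℝ] (G.Dart → ℝ) :=
    (coboundary G ∘ₗ Function.ExtendByZero.linearMap ℝ (Subtype.val : A → V)).coprod
      (R.faceDiff ∘ₗ Function.ExtendByZero.linearMap ℝ (Subtype.val : C → R.Face))
  LinearMap.funLeft ℝ ℝ (Subtype.val : D → G.Dart) ∘ₗ
    M.coprod (LinearMap.mulLeft ℝ σ ∘ₗ M)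

lemma hodgeMap_apply (σ : G.Dart → ℝ) (A : Finset V) (C : Finset R.Face) (D : Finset G.Dart)
    (x : ((A → ℝ) × (C → ℝ)) × ((A → ℝ) × (C → ℝ))) (d : D) :
    R.hodgeMap σ A C D x d =
      (coboundary G (Function.extend Subtype.val x.1.1 0) d
        + R.faceDiff (Function.extend Subtype.val x.1.2 0) d)
      + σ d * (coboundary G (Function.extend Subtype.val x.2.1 0) d
        + R.faceDiff (Function.extend Subtype.val x.2.2 0) d) := rfl

variable [Fintype V] [DecidableRel G.Adj]

noncomputable instance : Fintype R.Face := Fintype.ofSurjective R.face R.face_surjective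

lemma sum_dart_symm (F : G.Dart → ℝ) : ∑ d : G.Dart, F d.symm = ∑ d, F d :=
  Equiv.sum_comp (SimpleGraph.Dart.symm_involutive (G := G)).toPerm F

/-- The coboundary telescopes around each face, so weighting it by a function constant on faces
gives sum zero. -/
lemma sum_faceDiff_mul_coboundary (g : R.Face → ℝ) (f : V → ℝ) :
    ∑ d, R.faceDiff g d * coboundary G f d = 0 := by
  have h1 : ∑ d : G.Dart, g (R.face d) * f d.snd = ∑ d : G.Dart, g (R.face d) * f d.fst := by
    rw [← Equiv.sum_comp R.facePerm (fun d => g (R.face d) * f d.fst)]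
    simp
  have h2 : ∑ d : G.Dart, g (R.face d.symm) * coboundary G f d
      = - ∑ d : G.Dart, g (R.face d) * coboundary G f d := by
    rw [← sum_dart_symm, ← Finset.sum_neg_distrib]
    simp only [SimpleGraph.Dart.symm_symm, coboundary_symm, mul_neg]
  have h3 : ∑ d : G.Dart, g (R.face d) * coboundary G f d = 0 := by
    simp only [coboundary_apply, mul_sub, Finset.sum_sub_distrib, h1, sub_self]
  simp only [faceDiff_apply, sub_mul, Finset.sum_sub_distrib, h2, h3, neg_zero, sub_zero]

/-- At every dart the square of the coboundary equals minus its product with the face difference, or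
both factors of the square vanish; by orthogonality the squares sum to zero. -/
lemma coboundary_eq_zero_of_add_eq_zero (f : V → ℝ) (g : R.Face → ℝ)
    (h : ∀ d, coboundary G f d = 0 ∨ coboundary G f d + R.faceDiff g d = 0) (d : G.Dart) :
    coboundary G f d = 0 := by
  have h0 : ∑ d, coboundary G f d * coboundary G f d = 0 := by
    rw [← neg_eq_zero, ← R.sum_faceDiff_mul_coboundary g f, ← Finset.sum_neg_distrib]
    refine Finset.sum_congr rfl fun d _ => ?_
    rcases h d with h | h
    · simp [h]
    · rw [eq_neg_of_add_eq_zero_right h]; ring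
  have := (Finset.sum_eq_zero_iff_of_nonneg (fun d _ => mul_self_nonneg _)).1 h0 d
    (Finset.mem_univ d)
  exact mul_self_eq_zero.1 this

lemma extend_val_eq_zero {α : Type*} {A : Finset α} {f : A → ℝ}
    (h : ∀ a ∈ A, Function.extend Subtype.val f 0 a = 0) : f = 0 := by
  ext a
  have := h a a.2
  rwa [Function.Injective.extend_apply Subtype.val_injective] at this

lemma extend_val_of_notMem {α : Type*} {A : Finset α} (f : A → ℝ) {a : α} (h : a ∉ A) :
    Function.extend Subtype.val f 0 a = 0 := by
  rw [Function.extend_apply']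
  · rfl
  · rintro ⟨b, rfl⟩
    exact h b.2

variable {R}

/-- By orthogonality the vertex part of a kernel element has zero coboundary, hence is constant, and
it vanishes at a vertex outside `A`. The face part is then constant across `D`, and `hC` ties it to
its value `0` at `o`. -/
lemma hodgeMap_injective (hG : G.Connected) {σ : G.Dart → ℝ}
    (hσ : ∀ d, σ d ≠ 0 ∧ σ d.symm = - σ d)
    {A : Finset V} (hA : ∃ v, v ∉ A) {o : R.Face} {C : Finset R.Face} (ho : o ∉ C)
    {D : Finset G.Dart} (hD : ∀ d ∈ D, d.symm ∈ D) (hAD : ∀ d : G.Dart, d.fst ∈ A → d ∈ D)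
    (hC : ∀ g : R.Face → ℝ, (∀ d ∈ D, g (R.face d) = g (R.face d.symm)) → ∀ f ∈ C, g f = g o) :
    Function.Injective (R.hodgeMap σ A C D) := by
  have key : ∀ (f : A → ℝ) (g : C → ℝ),
      (∀ d ∈ D, coboundary G (Function.extend Subtype.val f 0) d
        + R.faceDiff (Function.extend Subtype.val g 0) d = 0) → f = 0 ∧ g = 0 := by
    intro f g h
    have h0 : ∀ d, coboundary G (Function.extend Subtype.val f 0) d = 0 := by
      refine R.coboundary_eq_zero_of_add_eq_zero _ (Function.extend Subtype.val g 0) fun d => ?_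
      by_cases hd : d ∈ D
      · exact Or.inr (h d hd)
      · left
        have h1 : d.fst ∉ A := fun h => hd (hAD d h)
        have h2 : d.snd ∉ A := fun h => hd (by simpa using hD _ (hAD d.symm h))
        rw [coboundary_apply, extend_val_of_notMem _ h1, extend_val_of_notMem _ h2, sub_zero]
    obtain ⟨v, hv⟩ := hA
    refine ⟨extend_val_eq_zero fun a _ => ?_, extend_val_eq_zero fun a ha => ?_⟩
    · rw [eq_of_coboundary_eq_zero hG h0 a v, extend_val_of_notMem _ hv]
    · refine (hC (Function.extend Subtype.val g 0) (fun d hd => ?_) a ha).trans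
        (extend_val_of_notMem _ ho)
      have := h d hd
      rwa [h0, zero_add, faceDiff_apply, sub_eq_zero] at this
  rw [← LinearMap.ker_eq_bot, LinearMap.ker_eq_bot']
  rintro ⟨⟨f, g⟩, ⟨f', g'⟩⟩ h
  have h1 : ∀ d (hd : d ∈ D), _ := fun d hd =>
    (R.hodgeMap_apply σ A C D _ ⟨d, hd⟩).symm.trans (congrFun h ⟨d, hd⟩)
  -- The equations at `d` and `d.symm` differ in the sign of the antisymmetric part only, so their
  -- sum and difference separate the two copies.
  have h2 := fun d hd => h1 d.symm (hD d hd)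
  simp only [Pi.zero_apply, coboundary_symm, faceDiff_symm, (hσ _).2] at h1 h2
  obtain ⟨rfl, rfl⟩ := key f g fun d hd => by linarith [h1 d hd, h2 d hd]
  obtain ⟨rfl, rfl⟩ := key f' g' fun d hd => by
    have := h1 d hd
    have h3 := h2 d hd
    refine (mul_eq_zero.1 ?_).resolve_left (hσ d).1
    linarith
  rfl

lemma two_mul_card_add_card_le (hG : G.Connected)
    {A : Finset V} (hA : ∃ v, v ∉ A) {o : R.Face} {C : Finset R.Face} (ho : o ∉ C)
    {D : Finset G.Dart} (hD : ∀ d ∈ D, d.symm ∈ D) (hAD : ∀ d : G.Dart, d.fst ∈ A → d ∈ D)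
    (hC : ∀ g : R.Face → ℝ, (∀ d ∈ D, g (R.face d) = g (R.face d.symm)) → ∀ f ∈ C, g f = g o) :
    2 * (A.card + C.card) ≤ D.card := by
  obtain ⟨σ, hσ⟩ := exists_antisymmetric_sign G
  have := LinearMap.finrank_le_finrank_of_injective
    (hodgeMap_injective hG hσ hA ho hD hAD hC)
  simp only [Module.finrank_prod, Module.finrank_fintype_fun_eq_card, Fintype.card_coe] at this
  omega

lemma IsPlanar.card_dart (h : R.IsPlanar) :
    Fintype.card G.Dart + 4 = 2 * (Fintype.card V + Fintype.card R.Face) := by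
  have h1 := h.2
  rw [Nat.card_eq_fintype_card, Nat.card_eq_fintype_card, Nat.card_eq_fintype_card,
    ← SimpleGraph.edgeFinset_card] at h1
  have h2 := G.dart_card_eq_twice_card_edges
  omega

/-- On the sphere, every divergence-free flow is a difference of face potentials. -/
lemma IsPlanar.exists_faceDiff_eq (h : R.IsPlanar) (z : G.Dart → ℝ)
    (hz : ∀ d, z d.symm = - z d) (hdiv : ∀ f : V → ℝ, ∑ d, z d * coboundary G f d = 0) :
    ∃ g : R.Face → ℝ, ∀ d, z d = R.faceDiff g d := by
  by_cases hne : Nonempty G.Dart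
  swap
  · exact ⟨0, fun d => (hne ⟨d⟩).elim⟩
  obtain ⟨d₀⟩ := hne
  obtain ⟨σ, hσ⟩ := exists_antisymmetric_sign G
  have hinj : Function.Injective (R.hodgeMap σ (Finset.univ.erase d₀.fst)
      (Finset.univ.erase (R.face d₀)) Finset.univ) :=
    hodgeMap_injective h.1 hσ ⟨d₀.fst, Finset.notMem_erase _ _⟩ (Finset.notMem_erase _ _)
      (fun _ _ => Finset.mem_univ _) (fun _ _ => Finset.mem_univ _)
      (fun g hg f _ => R.face_function_const h.1 g (fun d => hg d (Finset.mem_univ d)) f _)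
  -- With one vertex and one face removed, Euler's formula says exactly that the two dimensions
  -- agree.
  have hsurj := (LinearMap.injective_iff_surjective_of_finrank_eq_finrank (by
    have h1 := h.card_dart
    have h2 : 0 < Fintype.card V := Fintype.card_pos_iff.2 ⟨d₀.fst⟩
    have h3 : 0 < Fintype.card R.Face := Fintype.card_pos_iff.2 ⟨R.face d₀⟩
    simp only [Module.finrank_prod, Module.finrank_fintype_fun_eq_card, Fintype.card_coe,
      Finset.card_erase_of_mem (Finset.mem_univ _), Finset.card_univ]
    omega)).1 hinj
  obtain ⟨⟨⟨f, g⟩, ⟨f', g'⟩⟩, hx⟩ := hsurj (fun d => z d)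
  have h1 : ∀ d : G.Dart, _ := fun d =>
    (R.hodgeMap_apply σ _ _ _ _ ⟨d, Finset.mem_univ d⟩).symm.trans
      (congrFun hx ⟨d, Finset.mem_univ d⟩)
  have h2 := fun d : G.Dart => h1 d.symm
  simp only [coboundary_symm, faceDiff_symm, (hσ _).2, hz] at h1 h2
  set F : V → ℝ := Function.extend Subtype.val f 0
  set K : R.Face → ℝ := Function.extend Subtype.val g 0
  have h3 : ∀ d, z d = coboundary G F d + R.faceDiff K d := fun d => by
    linarith [h1 d, h2 d]
  -- Being divergence-free means being orthogonal to all coboundaries, which kills the vertex part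
  -- `F`.
  have h4 : ∑ d, coboundary G F d * coboundary G F d = 0 := by
    have := hdiv F
    simp only [h3, add_mul, Finset.sum_add_distrib, sum_faceDiff_mul_coboundary, add_zero] at this
    exact this
  refine ⟨K, fun d => ?_⟩
  have h5 := (Finset.sum_eq_zero_iff_of_nonneg (fun d _ => mul_self_nonneg _)).1 h4 d
    (Finset.mem_univ d)
  rw [h3, mul_self_eq_zero.1 h5, zero_add]

end LinearAlgebra
-- Regions enclosed by a set of edges
section Region

variable {V : Type*} [Fintype V] {G : SimpleGraph V} [DecidableRel G.Adj] (R : RotationSystem G)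

/-- The faces separated from the face `o` by the edge set `Z`. -/
noncomputable def enclosed (o : R.Face) (Z : Set (Sym2 V)) : Finset R.Face :=
  Finset.univ.filter fun f => ¬ Relation.ReflTransGen
    (fun f₁ f₂ => ∃ d : G.Dart, d.edge ∉ Z ∧ R.face d = f₁ ∧ R.face d.symm = f₂) o f

variable {R} {o : R.Face} {Z : Set (Sym2 V)}

lemma notMem_enclosed {f : R.Face} : f ∉ R.enclosed o Z ↔ Relation.ReflTransGen
    (fun f₁ f₂ => ∃ d : G.Dart, d.edge ∉ Z ∧ R.face d = f₁ ∧ R.face d.symm = f₂) o f := by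
  simp [enclosed]

lemma base_notMem_enclosed : o ∉ R.enclosed o Z := notMem_enclosed.2 .refl

lemma symm_mem_enclosed {d : G.Dart} (h : R.face d ∈ R.enclosed o Z) (hZ : d.edge ∉ Z) :
    R.face d.symm ∈ R.enclosed o Z := by
  by_contra h'
  exact notMem_enclosed.2 ((notMem_enclosed.1 h').tail
    ⟨d.symm, by rwa [SimpleGraph.Dart.edge_symm], rfl, by rw [SimpleGraph.Dart.symm_symm]⟩) h

lemma eq_base_of_notMem_enclosed {α : Type*} {g : R.Face → α}
    (hg : ∀ d : G.Dart, R.face d ∉ R.enclosed o Z → R.face d.symm ∉ R.enclosed o Z →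
      d.edge ∉ Z → g (R.face d) = g (R.face d.symm)) {f : R.Face} (hf : f ∉ R.enclosed o Z) :
    g f = g o := by
  rw [notMem_enclosed] at hf
  induction hf with
  | refl => rfl
  | tail h₁ h₂ ih =>
    obtain ⟨d, hd, rfl, rfl⟩ := h₂
    rw [← ih, hg d (notMem_enclosed.2 h₁) (notMem_enclosed.2 (h₁.tail ⟨d, hd, rfl, rfl⟩)) hd]

/-- Replacing edges of `Z` by edges of enclosed faces shrinks the enclosed region. -/
lemma enclosed_ssubset {Z' : Set (Sym2 V)}
    (h : ∀ d : G.Dart, d.edge ∈ Z' → d.edge ∈ Z ∨ R.face d ∈ R.enclosed o Z ∨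
      R.face d.symm ∈ R.enclosed o Z)
    {d₀ : G.Dart} (hd₀ : R.face d₀ ∈ R.enclosed o Z) (hd₀' : R.face d₀.symm ∉ R.enclosed o Z)
    (hZ : d₀.edge ∉ Z') : R.enclosed o Z' ⊂ R.enclosed o Z := by
  have hsub : R.enclosed o Z' ⊆ R.enclosed o Z := by
    intro f
    contrapose
    intro hf
    have hf' := hf
    rw [notMem_enclosed] at hf
    induction hf with
    | refl => exact base_notMem_enclosed
    | tail h₁ h₂ ih =>
      obtain ⟨d, hd, rfl, rfl⟩ := h₂
      have hd1 := notMem_enclosed.2 h₁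
      intro h3
      refine ih hd1 ?_
      have := symm_mem_enclosed h3 (by
        rw [SimpleGraph.Dart.edge_symm]
        intro h4
        rcases h d h4 with h5 | h5 | h5
        · exact hd h5
        · exact hd1 h5
        · exact hf' h5)
      rwa [SimpleGraph.Dart.symm_symm] at this
  refine (Finset.ssubset_iff_of_subset hsub).2 ⟨_, hd₀, fun h3 => ?_⟩
  exact hd₀' (hsub (symm_mem_enclosed h3 hZ))

/-- A nonzero divergence-free flow supported on `Z` encloses a face. -/
lemma enclosed_nonempty (hR : R.IsPlanar) {z : G.Dart → ℝ}
    (hz : ∀ d, z d.symm = - z d) (hdiv : ∀ f : V → ℝ, ∑ d, z d * coboundary G f d = 0)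
    (hsupp : ∀ d, d.edge ∉ Z → z d = 0) {d₀ : G.Dart} (hd₀ : z d₀ ≠ 0) :
    (R.enclosed o Z).Nonempty := by
  obtain ⟨g, hg⟩ := hR.exists_faceDiff_eq z hz hdiv
  by_contra hS
  rw [Finset.not_nonempty_iff_eq_empty] at hS
  have hconst : ∀ f, g f = g o := fun f =>
    eq_base_of_notMem_enclosed (o := o) (Z := Z)
      (fun d _ _ hd => sub_eq_zero.1 ((hg d).symm.trans (hsupp d hd))) (by simp [hS])
  exact hd₀ (by rw [hg, faceDiff_apply, hconst, hconst (R.face d₀.symm), sub_self])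

end Region

/-! ### Curvature and the Gauss–Bonnet inequality -/

section Curvature

variable {V : Type*} [Fintype V] {G : SimpleGraph V} [DecidableRel G.Adj] (R : RotationSystem G)

/-- The number of corners at `v` of the faces in `S`. -/
noncomputable def cornerCount (S : Finset R.Face) (v : V) : ℕ :=
  (Finset.univ.filter fun d : G.Dart => d.fst = v ∧ R.face d ∈ S).card

/-- The number of maximal angular sectors of `S` at `v`, if `S` does not surround `v`. -/
noncomputable def sectorCount (S : Finset R.Face) (v : V) : ℕ :=
  (Finset.univ.filter fun d : G.Dart => d.fst = v ∧ R.face d ∉ S ∧ R.face d.symm ∈ S).card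

/-- Six times the contribution of `v` to the Euler characteristic of the union of the triangles
in `S`. -/
noncomputable def curvature (S : Finset R.Face) (v : V) : ℤ :=
  if ∃ d : G.Dart, d.fst = v ∧ R.face d ∈ S then
    6 - R.cornerCount S v - 3 * R.sectorCount S v else 0

variable {R}

/-- Both counts vanish at a vertex off `S`, so the curvature can be summed term by term. -/
lemma curvature_eq (S : Finset R.Face) (v : V) :
    R.curvature S v = (if ∃ d : G.Dart, d.fst = v ∧ R.face d ∈ S then 6 else 0)
      - R.cornerCount S v - 3 * R.sectorCount S v := by
  unfold curvature
  split_ifs with h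
  · rfl
  · push Not at h
    have h1 : R.cornerCount S v = 0 := by
      rw [cornerCount, Finset.card_eq_zero, Finset.filter_eq_empty_iff]
      exact fun d _ hd => h d hd.1 hd.2
    have h2 : R.sectorCount S v = 0 := by
      rw [sectorCount, Finset.card_eq_zero, Finset.filter_eq_empty_iff]
      intro d _ hd
      exact h (R.rot d) ((R.fst_rot d).trans hd.1) (by rw [face_rot]; exact hd.2.2)
    simp [h1, h2]

lemma sum_card_filter_fst (P : G.Dart → Prop) :
    ∑ v, (Finset.univ.filter fun d : G.Dart => d.fst = v ∧ P d).card
      = (Finset.univ.filter P).card := by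
  rw [Finset.card_eq_sum_card_fiberwise (f := fun d : G.Dart => d.fst) (t := Finset.univ)
    (fun _ _ => Finset.mem_univ _)]
  refine Finset.sum_congr rfl fun v _ => ?_
  rw [Finset.filter_filter]
  congr 1
  ext d
  simp [and_comm]

lemma sum_cornerCount (S : Finset R.Face) : ∑ v, R.cornerCount S v
    = (Finset.univ.filter fun d : G.Dart => R.face d ∈ S).card := by
  unfold cornerCount
  convert sum_card_filter_fst fun d : G.Dart => R.face d ∈ S

lemma sum_sectorCount (S : Finset R.Face) : ∑ v, R.sectorCount S v
    = (Finset.univ.filter fun d : G.Dart => R.face d ∉ S ∧ R.face d.symm ∈ S).card := by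
  unfold sectorCount
  convert sum_card_filter_fst fun d : G.Dart => R.face d ∉ S ∧ R.face d.symm ∈ S

lemma card_filter_face_mem {S : Finset R.Face} (h3 : ∀ f ∈ S, (R.faceDarts f).ncard = 3) :
    (Finset.univ.filter fun d : G.Dart => R.face d ∈ S).card = 3 * S.card := by
  rw [Finset.card_eq_sum_card_fiberwise (f := R.face) (t := S) (by intro d; simp),
    Finset.sum_const_nat (m := 3), mul_comm]
  intro f hf
  rw [← h3 f hf, ← Set.ncard_coe_finset]
  congr 1
  ext d
  simp only [Finset.coe_filter, Finset.mem_filter, Finset.mem_univ, true_and, Set.mem_ofPred_eq,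
    mem_faceDarts, and_iff_right_iff_imp]
  rintro rfl
  exact hf

/-- Gauss–Bonnet inequality for the region enclosed by `Z`. -/
lemma six_le_sum_curvature (hR : R.IsPlanar) {o : R.Face} {Z : Set (Sym2 V)}
    (hne : (R.enclosed o Z).Nonempty)
    (h3 : ∀ f ∈ R.enclosed o Z, (R.faceDarts f).ncard = 3) :
    6 ≤ ∑ v, R.curvature (R.enclosed o Z) v := by
  set S := R.enclosed o Z with hS
  set W : Finset V := Finset.univ.filter fun v => ∃ d : G.Dart, d.fst = v ∧ R.face d ∈ S with hW
  set D : Finset G.Dart := Finset.univ.filter fun d => R.face d ∉ S ∧ R.face d.symm ∉ S with hD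
  -- This is the Euler inequality for the complement of the region, whose faces are all reachable
  -- from `o`. Subtracted from Euler's formula on the sphere, it bounds the Euler characteristic of
  -- the region from below.
  have h1 : 2 * (Wᶜ.card + ((Finset.univ \ S).erase o).card) ≤ D.card := by
    refine two_mul_card_add_card_le (o := o) hR.1 ?_ (Finset.notMem_erase _ _) ?_ ?_ ?_
    · obtain ⟨f, hf⟩ := hne
      obtain ⟨d, rfl⟩ := R.face_surjective f
      exact ⟨d.fst, by simpa [hW] using ⟨d, rfl, hf⟩⟩
    · intro d
      simp [hD, and_comm]
    · intro d hd
      simp only [hW, Finset.mem_compl, Finset.mem_filter, Finset.mem_univ, true_and,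
        not_exists, not_and] at hd
      simp only [hD, Finset.mem_filter, Finset.mem_univ, true_and]
      refine ⟨hd d rfl, ?_⟩
      rw [← face_rot]
      exact hd _ (R.fst_rot d)
    · intro g hg f hf
      refine eq_base_of_notMem_enclosed (Z := Z) (fun d hd1 hd2 _ => hg d ?_) ?_
      · simpa [hD] using ⟨hd1, hd2⟩
      · simpa using (Finset.mem_of_mem_erase hf)
  have h4 := hR.card_dart
  have h5 : ((Finset.univ \ S).erase o).card + 1 + S.card = Fintype.card R.Face := by
    rw [Finset.card_erase_add_one (by simpa using base_notMem_enclosed),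
      Finset.card_sdiff_add_card_eq_card (Finset.subset_univ _), Finset.card_univ]
  have h6 : Wᶜ.card + W.card = Fintype.card V := by
    rw [Finset.card_compl, Nat.sub_add_cancel (Finset.card_le_univ _)]
  have h7 := card_filter_face_mem h3
  have h8 : (Finset.univ.filter fun d : G.Dart => R.face d ∈ S).card
      + (Finset.univ.filter fun d : G.Dart => R.face d ∉ S ∧ R.face d.symm ∈ S).card
      + D.card = Fintype.card G.Dart := by
    rw [← Finset.card_union_of_disjoint, ← Finset.card_union_of_disjoint, ← Finset.card_univ]
    · congr 1
      ext d
      simp only [hD, Finset.mem_union, Finset.mem_filter, Finset.mem_univ, true_and, iff_true]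
      tauto
    · rw [Finset.disjoint_left]
      intro d
      simp only [hD, Finset.mem_union, Finset.mem_filter, Finset.mem_univ, true_and]
      tauto
    · rw [Finset.disjoint_left]
      intro d
      simp only [Finset.mem_filter, Finset.mem_univ, true_and]
      tauto
  have h9 : ∑ v, R.curvature S v = 6 * W.card
      - (Finset.univ.filter fun d : G.Dart => R.face d ∈ S).card
      - 3 * (Finset.univ.filter fun d : G.Dart => R.face d ∉ S ∧ R.face d.symm ∈ S).card := by
    simp only [curvature_eq, Finset.sum_sub_distrib, ← Finset.mul_sum]
    congr 2
    · rw [← Finset.sum_filter, Finset.sum_const, nsmul_eq_mul, mul_comm]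
    · rw [← sum_cornerCount]; push_cast; rfl
    · rw [← sum_sectorCount]; push_cast; rfl
  rw [h9]
  omega

end Curvature
end RotationSystem

namespace DiscTriangulation

open scoped Classical

lemma face_of_edge_eq {V : Type*} {G : SimpleGraph V} {T : DiscTriangulation G}
    {S : Finset T.Face} {d e : G.Dart} (h : T.face d ∈ S) (he : e.edge = d.edge) :
    T.face e ∈ S ∨ T.face e.symm ∈ S := by
  rcases (SimpleGraph.dart_edge_eq_iff e d).1 he with rfl | rfl
  · exact Or.inl h
  · right
    rwa [SimpleGraph.Dart.symm_symm]

/-! ### Local shape of a region at a vertex -/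

section Local

variable {V : Type*} [Fintype V] {G : SimpleGraph V} [DecidableRel G.Adj]
  {T : DiscTriangulation G}

lemma cornerCount_eq_degree_of_forall {S : Finset T.Face} {v : V}
    (h : ∀ d : G.Dart, d.fst = v → T.face d ∈ S) : T.cornerCount S v = G.degree v := by
  rw [← G.dart_fst_fiber_card_eq_degree, RotationSystem.cornerCount]
  congr 1
  ext d
  simp only [Finset.mem_filter, Finset.mem_univ, true_and]
  exact ⟨fun h => h.1, fun hd => ⟨hd, h d hd⟩⟩

/-- A surrounded vertex is internal and has curvature `6 - degree`. Otherwise there is at least one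
sector, so the curvature is at most `3` minus the number of corners. Walking back from a boundary
dart by `rot.symm` counts corners until the sector ends; three of them already give `≤ 0`. -/
lemma curvature_trichotomy (hdeg : ∀ v : V, T.IsInternal v → 6 ≤ G.degree v)
    {S : Finset T.Face} (hS : T.outer ∉ S) (v : V) :
    T.curvature S v ≤ 0 ∨ ∃ d : G.Dart, d.fst = v ∧ T.face d ∈ S ∧ T.face d.symm ∉ S ∧
      ((T.face (T.rot.symm d) ∉ S ∧ T.curvature S v ≤ 2) ∨
        (T.face (T.rot.symm d) ∈ S ∧ T.face (T.rot.symm (T.rot.symm d)) ∉ S ∧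
          T.curvature S v ≤ 1)) := by
  by_cases hK : ∃ d : G.Dart, d.fst = v ∧ T.face d ∈ S
  swap
  · left
    rw [RotationSystem.curvature, if_neg hK]
  have hcurv : T.curvature S v = 6 - T.cornerCount S v - 3 * T.sectorCount S v := by
    rw [RotationSystem.curvature, if_pos hK]
  by_cases hb : ∃ d : G.Dart, d.fst = v ∧ T.face d ∈ S ∧ T.face d.symm ∉ S
  swap
  · left
    push Not at hb
    obtain ⟨d₀, rfl, hd₀⟩ := hK
    have hall : ∀ d : G.Dart, d.fst = d₀.fst → T.face d ∈ S := fun d hd =>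
      T.rot_induction (P := fun d => T.face d ∈ S)
        (fun a ha h => by rw [RotationSystem.face_rot]; exact hb a ha h) hd.symm hd₀
    have h6 := hdeg d₀.fst (fun d hd hv => hS (by
      rw [← T.mem_faceDarts.1 hd]
      exact hall d hv))
    rw [hcurv, cornerCount_eq_degree_of_forall hall]
    omega
  obtain ⟨d, rfl, hd, hd'⟩ := hb
  -- Without a transition between sectors, rotating from a face outside `S` would never enter `S`.
  have hsec : 1 ≤ T.sectorCount S d.fst := by
    rw [RotationSystem.sectorCount, Nat.one_le_iff_ne_zero, Finset.card_ne_zero]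
    by_contra hemp
    rw [Finset.not_nonempty_iff_eq_empty, Finset.filter_eq_empty_iff] at hemp
    refine T.rot_induction (P := fun e => T.face e ∉ S) (d := T.rot d) (e := d) ?_
      (T.fst_rot d) (by rwa [RotationSystem.face_rot]) hd
    intro a ha h h'
    rw [RotationSystem.face_rot] at h'
    exact hemp (Finset.mem_univ a) ⟨ha.trans (T.fst_rot d), h, h'⟩
  have hcorner : ∀ A : Finset G.Dart, (∀ a ∈ A, a.fst = d.fst ∧ T.face a ∈ S) →
      A.card ≤ T.cornerCount S d.fst := fun A hA =>
    Finset.card_le_card fun a ha => by simpa using hA a ha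
  have h1 := T.face_symm_rot_symm d
  have h2 := T.face_symm_rot_symm (T.rot.symm d)
  have f1 := T.fst_rot_symm d
  have f2 := T.fst_rot_symm (T.rot.symm d)
  have n1 : d ≠ T.rot.symm d := fun h => hd' (by rw [h, h1]; exact hd)
  by_cases hd1 : T.face (T.rot.symm d) ∈ S
  swap
  · right
    refine ⟨d, rfl, hd, hd', Or.inl ⟨hd1, ?_⟩⟩
    have := hcorner {d} (by simpa using hd)
    rw [Finset.card_singleton] at this
    rw [hcurv]
    omega
  by_cases hd2 : T.face (T.rot.symm (T.rot.symm d)) ∈ S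
  swap
  · right
    refine ⟨d, rfl, hd, hd', Or.inr ⟨hd1, hd2, ?_⟩⟩
    have := hcorner {d, T.rot.symm d} (by simp [hd, hd1, f1])
    rw [Finset.card_pair n1] at this
    rw [hcurv]
    omega
  left
  have n2 : T.rot.symm d ≠ T.rot.symm (T.rot.symm d) := fun h => n1 (T.rot.symm.injective h)
  have n3 : d ≠ T.rot.symm (T.rot.symm d) := fun h => hd' (by rw [h, h2]; exact hd1)
  have := hcorner {d, T.rot.symm d, T.rot.symm (T.rot.symm d)} (by simp [hd, hd1, hd2, f1, f2])
  rw [Finset.card_eq_three.2 ⟨_, _, _, n1, n3, n2, rfl⟩] at this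
  rw [hcurv]
  omega

/-- The third side of the internal triangle with corner at `d`. -/
lemma exists_third_side {d : G.Dart} (h : T.face d ≠ T.outer) :
    ∃ e : G.Dart, e.fst = d.snd ∧ e.snd = (T.rot.symm d).snd ∧ T.face e = T.face d :=
  ⟨T.facePerm d, T.facePerm_fst d,
    T.snd_facePerm_of_ncard_eq_three (T.internal_triangle _ h), T.face_facePerm d⟩

/-- The shape of an enclosed region at a vertex where at most two edges of `Z` meet. -/
lemma curvature_cases (hdeg : ∀ v : V, T.IsInternal v → 6 ≤ G.degree v) {Z : Set (Sym2 V)}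
    {v a b : V} (hZ : ∀ d : G.Dart, d.fst = v → d.edge ∈ Z → d.snd = a ∨ d.snd = b) :
    T.curvature (T.enclosed T.outer Z) v ≤ 0 ∨
    (T.curvature (T.enclosed T.outer Z) v ≤ 2 ∧ G.Adj a b ∧
      ∃ d : G.Dart, d.fst = v ∧ T.face d ≠ T.outer ∧ s(d.snd, (T.rot.symm d).snd) = s(a, b)) ∨
    (T.curvature (T.enclosed T.outer Z) v ≤ 1 ∧ ∃ w, G.Adj a w ∧ G.Adj w b ∧ G.Adj v w ∧
      (∃ d : G.Dart, d.fst = v ∧ T.face d ∈ T.enclosed T.outer Z ∧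
        T.face d.symm ∉ T.enclosed T.outer Z) ∧
      ∀ e : G.Dart, e.edge = s(a, w) ∨ e.edge = s(w, b) →
        T.face e ∈ T.enclosed T.outer Z ∨ T.face e.symm ∈ T.enclosed T.outer Z) := by
  set S := T.enclosed T.outer Z
  have hS : T.outer ∉ S := RotationSystem.base_notMem_enclosed
  have hbd : ∀ d : G.Dart, T.face d ∈ S → T.face d.symm ∉ S → d.edge ∈ Z := by
    intro d h h'
    by_contra h''
    exact h' (RotationSystem.symm_mem_enclosed h h'')
  have hbd' : ∀ d : G.Dart, T.face d ∉ S → T.face d.symm ∈ S → d.edge ∈ Z := by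
    intro d h h'
    rw [← SimpleGraph.Dart.edge_symm]
    exact hbd _ h' (by rwa [SimpleGraph.Dart.symm_symm])
  have hinj : ∀ d e : G.Dart, d.fst = v → e.fst = v → d.snd = e.snd → d = e := by
    intro d e h1 h2 h3
    exact SimpleGraph.Dart.ext _ _ (Prod.ext (h1.trans h2.symm) h3)
  rcases curvature_trichotomy hdeg hS v with h | ⟨d, hdv, hd, hd', ⟨h1, hk⟩ | ⟨h1, h2, hk⟩⟩
  · exact Or.inl h
  · right; left
    have hdZ := hZ d hdv (hbd d hd hd')
    have hf1 := T.face_symm_rot_symm d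
    have hv1 := (T.fst_rot_symm d).trans hdv
    have heZ := hZ _ hv1 (hbd' _ h1 (by rwa [hf1]))
    have hne : d.snd ≠ (T.rot.symm d).snd := fun h => h1 (by
      rw [← hinj _ _ hdv hv1 h]; exact hd)
    have ho : T.face d ≠ T.outer := fun h => hS (h ▸ hd)
    obtain ⟨e, he1, he2, -⟩ := exists_third_side ho
    have hadj := e.adj
    rw [he1, he2] at hadj
    refine ⟨hk, ?_, d, hdv, ho, ?_⟩
    · rcases hdZ with h | h <;> rcases heZ with h' | h' <;> rw [h, h'] at hadj
      · exact absurd hadj (G.irrefl)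
      · exact hadj
      · exact hadj.symm
      · exact absurd hadj (G.irrefl)
    · rcases hdZ with h | h <;> rcases heZ with h' | h' <;> rw [h, h'] at hne ⊢
      · exact absurd rfl hne
      · exact Sym2.eq_swap
      · exact absurd rfl hne
  · right; right
    set d₁ := T.rot.symm d
    set d₂ := T.rot.symm d₁
    have hdZ := hZ d hdv (hbd d hd hd')
    have hf1 : T.face d₁.symm = T.face d := T.face_symm_rot_symm d
    have hf2 : T.face d₂.symm = T.face d₁ := T.face_symm_rot_symm d₁
    have hv1 : d₁.fst = v := (T.fst_rot_symm d).trans hdv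
    have hv2 : d₂.fst = v := (T.fst_rot_symm d₁).trans hv1
    have heZ := hZ d₂ hv2 (hbd' _ h2 (by rwa [hf2]))
    have hne : d.snd ≠ d₂.snd := fun h => h2 (by
      rw [← hinj _ _ hdv hv2 h]; exact hd)
    have ho : T.face d ≠ T.outer := fun h => hS (h ▸ hd)
    have ho1 : T.face d₁ ≠ T.outer := fun h => hS (h ▸ h1)
    obtain ⟨e, he1, he2, he3⟩ := exists_third_side ho
    obtain ⟨e', he1', he2', he3'⟩ := exists_third_side ho1
    have hadj : G.Adj d.snd d₁.snd := by rw [← he1, ← he2]; exact e.adj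
    have hadj' : G.Adj d₁.snd d₂.snd := by rw [← he1', ← he2']; exact e'.adj
    have hE : e.edge = s(d.snd, d₁.snd) := by rw [← he1, ← he2]; rfl
    have hE' : e'.edge = s(d₁.snd, d₂.snd) := by rw [← he1', ← he2']; rfl
    have heS : T.face e ∈ S := he3 ▸ hd
    have heS' : T.face e' ∈ S := he3' ▸ h1
    refine ⟨hk, d₁.snd, ?_⟩
    have hadjv : G.Adj v d₁.snd := hv1 ▸ d₁.adj
    rcases hdZ with h | h <;> rcases heZ with h' | h' <;> rw [h, h'] at hne
    · exact absurd rfl hne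
    · rw [h] at hadj hE
      rw [h'] at hadj' hE'
      refine ⟨hadj, hadj', hadjv, ⟨d, hdv, hd, hd'⟩, ?_⟩
      rintro c (hc | hc)
      · exact face_of_edge_eq heS (hc.trans hE.symm)
      · exact face_of_edge_eq heS' (hc.trans hE'.symm)
    · rw [h] at hadj hE
      rw [h'] at hadj' hE'
      refine ⟨hadj'.symm, hadj.symm, hadjv, ⟨d, hdv, hd, hd'⟩, ?_⟩
      rintro c (hc | hc)
      · exact face_of_edge_eq heS' (hc.trans (Sym2.eq_swap.trans hE'.symm))
      · exact face_of_edge_eq heS (hc.trans (Sym2.eq_swap.trans hE.symm))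
    · exact absurd rfl hne

end Local
-- Geodesics and bigons
section Bigon

variable {V : Type*} {G : SimpleGraph V}

/-- The first `n` steps of `p` form a geodesic starting at `x`. -/
structure IsGeodesic (G : SimpleGraph V) (x : V) (n : ℕ) (p : ℕ → V) : Prop where
  zero : p 0 = x
  adj : ∀ i < n, G.Adj (p i) (p (i + 1))
  dist : ∀ i ≤ n, G.dist x (p i) = i

lemma exists_isGeodesic (hG : G.Connected) {x u : V} {n : ℕ} (h : G.dist x u = n) :
    ∃ p, IsGeodesic G x n p ∧ p n = u := by
  induction n generalizing u with
  | zero =>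
    refine ⟨fun _ => x, ⟨rfl, fun i hi => absurd hi (Nat.not_lt_zero i), fun i hi => ?_⟩,
      hG.dist_eq_zero_iff.1 h⟩
    simp [Nat.le_zero.1 hi]
  | succ n ih =>
    obtain ⟨w, hw⟩ := hG.exists_walk_length_eq_dist x u
    have hn : w.length = n + 1 := hw.trans h
    have hlast : w.getVert (n + 1) = u := hn ▸ w.getVert_length
    have hadj : G.Adj (w.getVert n) u := by
      have := w.adj_getVert_succ (i := n) (by omega)
      rwa [hlast] at this
    have h1 : G.dist x (w.getVert n) ≤ n :=
      (SimpleGraph.dist_le (w.take n)).trans (by simp)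
    have h2 := hG.dist_triangle (u := x) (v := w.getVert n) (w := u)
    rw [SimpleGraph.dist_eq_one_iff_adj.2 hadj, h] at h2
    obtain ⟨p, hp, hpn⟩ := ih (le_antisymm h1 (by omega))
    refine ⟨Function.update p (n + 1) u, ⟨?_, fun i hi => ?_, fun i hi => ?_⟩, by simp⟩
    · rw [Function.update_of_ne (by omega), hp.zero]
    · rw [Function.update_of_ne (by omega)]
      rcases Nat.lt_succ_iff_lt_or_eq.1 hi with hi | rfl
      · rw [Function.update_of_ne (by omega)]
        exact hp.adj i hi
      · rw [Function.update_self, hpn]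
        exact hadj
    · rcases Nat.le_succ_iff.1 hi with hi | rfl
      · rw [Function.update_of_ne (by omega)]
        exact hp.dist i hi
      · rw [Function.update_self, h]

lemma dist_le_succ_of_adj (hG : G.Connected) (x : V) {u v : V} (h : G.Adj u v) :
    G.dist x v ≤ G.dist x u + 1 := by
  have := hG.dist_triangle (u := x) (v := u) (w := v)
  rwa [SimpleGraph.dist_eq_one_iff_adj.2 h] at this

namespace IsGeodesic

variable {x : V} {n : ℕ} {p q : ℕ → V}

/-- The index is the distance from `x`, so geodesics from `x` can meet only at equal indices. -/
lemma inj (hp : IsGeodesic G x n p) (hq : IsGeodesic G x n q) {i j : ℕ} (hi : i ≤ n) (hj : j ≤ n)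
    (h : p i = q j) : i = j := by
  rw [← hp.dist i hi, h, hq.dist j hj]

lemma dist_to_end (hG : G.Connected) (hp : IsGeodesic G x n p) {j : ℕ} (hj : j ≤ n) :
    G.dist (p j) (p n) = n - j := by
  have key : ∀ k, j + k ≤ n → G.dist (p j) (p (j + k)) ≤ k := by
    intro k
    induction k with
    | zero => simp
    | succ k ih =>
      intro h
      have := dist_le_succ_of_adj hG (p j) (hp.adj (j + k) (by omega))
      have := ih (by omega)
      rw [← add_assoc]
      omega
  have h1 := key (n - j) (by omega)
  rw [Nat.add_sub_cancel' hj] at h1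
  have h2 := hG.dist_triangle (u := x) (v := p j) (w := p n)
  rw [hp.dist j hj, hp.dist n le_rfl] at h2
  omega

/-- Replacing one inner vertex of a geodesic by another common neighbour. -/
lemma update (hG : G.Connected) (hp : IsGeodesic G x n p) {i : ℕ} (hi : i + 1 < n) {w : V}
    (h1 : G.Adj (p i) w) (h2 : G.Adj w (p (i + 2))) :
    IsGeodesic G x n (Function.update p (i + 1) w) := by
  refine ⟨?_, fun j hj => ?_, fun j hj => ?_⟩
  · rw [Function.update_of_ne (by omega), hp.zero]
  · by_cases h3 : j = i + 1
    · subst h3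
      rw [Function.update_self, Function.update_of_ne (by omega)]
      exact h2
    · rw [Function.update_of_ne h3]
      by_cases h4 : j = i
      · subst h4
        rw [Function.update_self]
        exact h1
      · rw [Function.update_of_ne (by omega)]
        exact hp.adj j hj
  · by_cases h3 : j = i + 1
    · subst h3
      rw [Function.update_self]
      have h4 := dist_le_succ_of_adj hG x h1
      have h5 := dist_le_succ_of_adj hG x h2
      rw [hp.dist _ (by omega)] at h4 h5
      omega
    · rw [Function.update_of_ne h3]
      exact hp.dist j hj

end IsGeodesic

/-- The edges of two geodesics of length `n`, together with the pair of their endpoints. -/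
def bigonEdges (p q : ℕ → V) (n : ℕ) : Set (Sym2 V) :=
  {e | (∃ i < n, e = s(p i, p (i + 1))) ∨ (∃ i < n, e = s(q i, q (i + 1))) ∨ e = s(p n, q n)}

lemma bigonEdges_comm (p q : ℕ → V) (n : ℕ) : bigonEdges p q n = bigonEdges q p n := by
  ext e
  simp only [bigonEdges, Set.mem_ofPred_eq]
  rw [Sym2.eq_swap (a := p n), or_left_comm]

variable {x : V} {n : ℕ} {p q : ℕ → V}

lemma snd_of_mem_bigonEdges {d : G.Dart} (h : d.edge ∈ bigonEdges p q n) :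
    (∃ i < n, d.fst = p i ∧ d.snd = p (i + 1)) ∨ (∃ i < n, d.fst = p (i + 1) ∧ d.snd = p i) ∨
    (∃ i < n, d.fst = q i ∧ d.snd = q (i + 1)) ∨ (∃ i < n, d.fst = q (i + 1) ∧ d.snd = q i) ∨
    (d.fst = p n ∧ d.snd = q n) ∨ (d.fst = q n ∧ d.snd = p n) := by
  have key : ∀ a b : V, d.edge = s(a, b) → (d.fst = a ∧ d.snd = b) ∨ (d.fst = b ∧ d.snd = a) :=
    fun a b h => Sym2.eq_iff.1 h
  rcases h with ⟨i, hi, h⟩ | ⟨i, hi, h⟩ | h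
  · rcases key _ _ h with h | h
    · exact Or.inl ⟨i, hi, h⟩
    · exact Or.inr (Or.inl ⟨i, hi, h⟩)
  · rcases key _ _ h with h | h
    · exact Or.inr (Or.inr (Or.inl ⟨i, hi, h⟩))
    · exact Or.inr (Or.inr (Or.inr (Or.inl ⟨i, hi, h⟩)))
  · exact Or.inr (Or.inr (Or.inr (Or.inr (key _ _ h))))

/-- This and the next three lemmas supply the hypothesis of `curvature_cases` at the side vertices
and corners of a bigon. -/
lemma snd_of_mem_bigonEdges_inner (hp : IsGeodesic G x n p) (hq : IsGeodesic G x n q)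
    {i : ℕ} (hi : i + 1 < n) (hne : p (i + 1) ≠ q (i + 1)) {d : G.Dart} (hd : d.fst = p (i + 1))
    (h : d.edge ∈ bigonEdges p q n) : d.snd = p i ∨ d.snd = p (i + 2) := by
  rcases snd_of_mem_bigonEdges h with ⟨j, hj, h1, h2⟩ | ⟨j, hj, h1, h2⟩ | ⟨j, hj, h1, h2⟩ |
    ⟨j, hj, h1, h2⟩ | ⟨h1, h2⟩ | ⟨h1, h2⟩ <;> rw [hd] at h1
  · obtain rfl := hp.inj hp (by omega) (by omega) h1
    exact Or.inr h2
  · have := hp.inj hp (by omega) (by omega) h1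
    obtain rfl : i = j := by omega
    exact Or.inl h2
  · obtain rfl := hp.inj hq (by omega) (by omega) h1
    exact absurd h1 hne
  · have := hp.inj hq (by omega) (by omega) h1
    obtain rfl : i = j := by omega
    exact absurd h1 hne
  · have := hp.inj hp (by omega) le_rfl h1
    omega
  · have := hp.inj hq (by omega) le_rfl h1
    omega

lemma snd_of_mem_bigonEdges_base (hp : IsGeodesic G x n p) (hq : IsGeodesic G x n q)
    (hn : 0 < n) {d : G.Dart} (hd : d.fst = x)
    (h : d.edge ∈ bigonEdges p q n) : d.snd = p 1 ∨ d.snd = q 1 := by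
  rcases snd_of_mem_bigonEdges h with ⟨j, hj, h1, h2⟩ | ⟨j, hj, h1, h2⟩ | ⟨j, hj, h1, h2⟩ |
    ⟨j, hj, h1, h2⟩ | ⟨h1, h2⟩ | ⟨h1, h2⟩ <;> rw [hd, ← hp.zero] at h1
  · obtain rfl := hp.inj hp (by omega) (by omega) h1
    exact Or.inl h2
  · have := hp.inj hp (by omega) (by omega) h1
    omega
  · obtain rfl := hp.inj hq (by omega) (by omega) h1
    exact Or.inr h2
  · have := hp.inj hq (by omega) (by omega) h1
    omega
  · have := hp.inj hp (by omega) le_rfl h1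
    omega
  · have := hp.inj hq (by omega) le_rfl h1
    omega

lemma snd_of_mem_bigonEdges_end {m : ℕ} (hp : IsGeodesic G x (m + 1) p)
    (hq : IsGeodesic G x (m + 1) q) (hne : p (m + 1) ≠ q (m + 1)) {d : G.Dart}
    (hd : d.fst = p (m + 1)) (h : d.edge ∈ bigonEdges p q (m + 1)) :
    d.snd = p m ∨ d.snd = q (m + 1) := by
  rcases snd_of_mem_bigonEdges h with ⟨j, hj, h1, h2⟩ | ⟨j, hj, h1, h2⟩ | ⟨j, hj, h1, h2⟩ |
    ⟨j, hj, h1, h2⟩ | ⟨h1, h2⟩ | ⟨h1, h2⟩ <;> rw [hd] at h1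
  · have := hp.inj hp (by omega) (by omega) h1
    omega
  · have := hp.inj hp (by omega) (by omega) h1
    obtain rfl : m = j := by omega
    exact Or.inl h2
  · have := hp.inj hq (by omega) (by omega) h1
    omega
  · have := hp.inj hq (by omega) (by omega) h1
    obtain rfl : m = j := by omega
    exact absurd h1 hne
  · exact Or.inr h2
  · exact absurd h1 hne

lemma snd_of_mem_bigonEdges_common_end {m : ℕ} (hp : IsGeodesic G x (m + 1) p)
    (hq : IsGeodesic G x (m + 1) q) (heq : p (m + 1) = q (m + 1)) {d : G.Dart}
    (hd : d.fst = p (m + 1)) (h : d.edge ∈ bigonEdges p q (m + 1)) :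
    d.snd = p m ∨ d.snd = q m := by
  have hloop : d.snd ≠ p (m + 1) := hd ▸ d.adj.ne'
  rcases snd_of_mem_bigonEdges h with ⟨j, hj, h1, h2⟩ | ⟨j, hj, h1, h2⟩ | ⟨j, hj, h1, h2⟩ |
    ⟨j, hj, h1, h2⟩ | ⟨h1, h2⟩ | ⟨h1, h2⟩ <;> rw [hd] at h1
  · have := hp.inj hp (by omega) (by omega) h1
    omega
  · have := hp.inj hp (by omega) (by omega) h1
    obtain rfl : m = j := by omega
    exact Or.inl h2
  · have := hp.inj hq (by omega) (by omega) h1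
    omega
  · have := hp.inj hq (by omega) (by omega) h1
    obtain rfl : m = j := by omega
    exact Or.inr h2
  · exact absurd (h2.trans heq.symm) hloop
  · exact absurd h2 hloop

end Bigon

/-! ### The flow around a bigon -/

section Flow

variable {V : Type*} {G : SimpleGraph V}

/-- The unit flow along the dart from `a` to `b`. -/
noncomputable def unitFlow (G : SimpleGraph V) (a b : V) (d : G.Dart) : ℝ :=
  (if d.fst = a ∧ d.snd = b then 1 else 0) - (if d.fst = b ∧ d.snd = a then 1 else 0)

lemma unitFlow_symm (a b : V) (d : G.Dart) : unitFlow G a b d.symm = - unitFlow G a b d := by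
  have h1 : d.symm.fst = d.snd := rfl
  have h2 : d.symm.snd = d.fst := rfl
  rw [unitFlow, unitFlow, h1, h2, neg_sub]
  simp only [and_comm]

lemma unitFlow_eq_zero {a b : V} {d : G.Dart} (h : d.edge ≠ s(a, b)) : unitFlow G a b d = 0 := by
  have h' : ¬ (d.fst = a ∧ d.snd = b ∨ d.fst = b ∧ d.snd = a) := fun h' => h (Sym2.eq_iff.2 h')
  push Not at h'
  rw [unitFlow, if_neg fun h => h'.1 h.1 h.2, if_neg fun h => h'.2 h.1 h.2, sub_zero]

variable [Fintype V] [DecidableRel G.Adj]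

lemma sum_unitFlow_mul_coboundary {a b : V} (h : a = b ∨ G.Adj a b) (f : V → ℝ) :
    ∑ d, unitFlow G a b d * RotationSystem.coboundary G f d = 2 * (f b - f a) := by
  have key : ∀ {a b : V}, G.Adj a b →
      ∑ d : G.Dart, (if d.fst = a ∧ d.snd = b then (1 : ℝ) else 0) *
        RotationSystem.coboundary G f d = f b - f a := by
    intro a b h
    rw [Finset.sum_eq_single (⟨(a, b), h⟩ : G.Dart)]
    · simp [RotationSystem.coboundary_apply]
    · intro d _ hd
      rw [if_neg, zero_mul]
      rintro ⟨h1, h2⟩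
      exact hd (SimpleGraph.Dart.ext _ _ (Prod.ext h1 h2))
    · exact fun h => absurd (Finset.mem_univ _) h
  rcases h with rfl | h
  · simp [unitFlow]
  · simp only [unitFlow, sub_mul, Finset.sum_sub_distrib, key h, key h.symm]
    ring

/-- The flow going up `p`, across the top and back down `q` is divergence-free, and it equals `1` on
the first dart of `p` because `q` starts differently. If the ends coincide, the top term is zero. -/
lemma enclosed_bigonEdges_nonempty {T : DiscTriangulation G} {x : V} {n : ℕ} {p q : ℕ → V}
    (hp : IsGeodesic G x n p) (hq : IsGeodesic G x n q) (htop : p n = q n ∨ G.Adj (p n) (q n))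
    (hn : 0 < n) (hne : p 1 ≠ q 1) : (T.enclosed T.outer (bigonEdges p q n)).Nonempty := by
  set z : G.Dart → ℝ := fun d => ∑ i ∈ Finset.range n, unitFlow G (p i) (p (i + 1)) d
    + unitFlow G (p n) (q n) d - ∑ i ∈ Finset.range n, unitFlow G (q i) (q (i + 1)) d with hz
  have h0 : G.Adj x (p 1) := hp.zero ▸ hp.adj 0 hn
  refine RotationSystem.enclosed_nonempty T.isPlanar (z := z) ?_ ?_ ?_ (d₀ := ⟨(x, p 1), h0⟩) ?_
  · intro d
    simp only [hz, unitFlow_symm, Finset.sum_neg_distrib]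
    ring
  · intro f
    have hsum : ∀ {r : ℕ → V}, IsGeodesic G x n r →
        ∑ d, (∑ i ∈ Finset.range n, unitFlow G (r i) (r (i + 1)) d) *
          RotationSystem.coboundary G f d = 2 * (f (r n) - f x) := by
      intro r hr
      simp only [Finset.sum_mul]
      rw [Finset.sum_comm, Finset.sum_congr rfl fun i hi =>
        sum_unitFlow_mul_coboundary (Or.inr (hr.adj i (Finset.mem_range.1 hi))) f,
        ← Finset.mul_sum, Finset.sum_range_sub (fun i => f (r i)), hr.zero]
    simp only [hz, sub_mul, add_mul, Finset.sum_sub_distrib, Finset.sum_add_distrib, hsum hp,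
      hsum hq, sum_unitFlow_mul_coboundary htop]
    ring
  · intro d hd
    have h1 : ∀ i ∈ Finset.range n, unitFlow G (p i) (p (i + 1)) d = 0 := fun i hi =>
      unitFlow_eq_zero fun h => hd (Or.inl ⟨i, Finset.mem_range.1 hi, h⟩)
    have h2 : ∀ i ∈ Finset.range n, unitFlow G (q i) (q (i + 1)) d = 0 := fun i hi =>
      unitFlow_eq_zero fun h => hd (Or.inr (Or.inl ⟨i, Finset.mem_range.1 hi, h⟩))
    have h3 : unitFlow G (p n) (q n) d = 0 :=
      unitFlow_eq_zero fun h => hd (Or.inr (Or.inr h))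
    simp only [hz, Finset.sum_eq_zero h1, Finset.sum_eq_zero h2, h3, add_zero, sub_zero]
  · have hx : ∀ {r : ℕ → V}, IsGeodesic G x n r → ∀ {i}, i ≤ n → i ≠ 0 → x ≠ r i := by
      intro r hr i hi hi0 h
      rw [← hr.zero] at h
      exact hi0 (hr.inj hr (Nat.zero_le n) hi h).symm
    have hstep : ∀ {r : ℕ → V}, IsGeodesic G x n r → ∀ i ∈ Finset.range n, i ≠ 0 →
        unitFlow G (r i) (r (i + 1)) ⟨(x, p 1), h0⟩ = 0 := by
      intro r hr i hi hi0
      rw [Finset.mem_range] at hi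
      simp [unitFlow, hx hr (i := i) (by omega) hi0, hx hr (i := i + 1) (by omega) (by omega)]
    have hend : unitFlow G (p n) (q n) ⟨(x, p 1), h0⟩ = 0 := by
      simp [unitFlow, hx hp le_rfl hn.ne', hx hq le_rfl hn.ne']
    have hq1 : unitFlow G (q 0) (q (0 + 1)) ⟨(x, p 1), h0⟩ = 0 := by
      simp [unitFlow, hne, hx hq (i := 1) (by omega) (by omega)]
    have hp1 : unitFlow G (p 0) (p (0 + 1)) ⟨(x, p 1), h0⟩ = 1 := by
      simp [unitFlow, hx hp (i := 1) (by omega) (by omega), hp.zero]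
    simp only [hz, hend]
    rw [Finset.sum_eq_single 0 (hstep hp) (fun h => absurd (Finset.mem_range.2 hn) h),
      Finset.sum_eq_single 0 (hstep hq) (fun h => absurd (Finset.mem_range.2 hn) h), hp1, hq1]
    norm_num

end Flow

/-! ### Curvature along the sides of a bigon -/

section BigonCurvature

variable {V : Type*} [Fintype V] {G : SimpleGraph V} [DecidableRel G.Adj]
  {T : DiscTriangulation G} {x : V} {n : ℕ} {p q : ℕ → V}

lemma six_le_sum_curvature_bigon
    (hp : IsGeodesic G x n p) (hq : IsGeodesic G x n q) (htop : p n = q n ∨ G.Adj (p n) (q n))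
    (hn : 0 < n) (hne : p 1 ≠ q 1) :
    6 ≤ ∑ v, T.curvature (T.enclosed T.outer (bigonEdges p q n)) v :=
  RotationSystem.six_le_sum_curvature T.isPlanar (enclosed_bigonEdges_nonempty hp hq htop hn hne)
    fun f hf => T.internal_triangle f fun h => RotationSystem.base_notMem_enclosed (h ▸ hf)

lemma curvature_nonpos_of_off (hdeg : ∀ v : V, T.IsInternal v → 6 ≤ G.degree v) {v : V}
    (h1 : ∀ i ≤ n, v ≠ p i) (h2 : ∀ i ≤ n, v ≠ q i) :
    T.curvature (T.enclosed T.outer (bigonEdges p q n)) v ≤ 0 := by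
  have hoff : ∀ d : G.Dart, d.fst = v → d.edge ∉ bigonEdges p q n := by
    rintro d rfl h
    rcases snd_of_mem_bigonEdges h with ⟨j, hj, h3, -⟩ | ⟨j, hj, h3, -⟩ | ⟨j, hj, h3, -⟩ |
      ⟨j, hj, h3, -⟩ | ⟨h3, -⟩ | ⟨h3, -⟩
    · exact h1 _ hj.le h3
    · exact h1 _ hj h3
    · exact h2 _ hj.le h3
    · exact h2 _ hj h3
    · exact h1 _ le_rfl h3
    · exact h2 _ le_rfl h3
  rcases curvature_cases (a := v) (b := v) hdeg (fun d hd h => absurd h (hoff d hd)) with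
    h | ⟨-, h, -⟩ | ⟨-, w, -, -, -, ⟨d, hd, h3, h4⟩, -⟩
  · exact h
  · exact absurd h G.irrefl
  · exact absurd (RotationSystem.symm_mem_enclosed h3 (hoff d hd)) h4

/-- In the two-triangle case, the vertex `w` shared by both triangles replaces `p (i + 1)`: the new
edges are sides of enclosed triangles, so the side moves inwards. -/
lemma curvature_inner (hdeg : ∀ v : V, T.IsInternal v → 6 ≤ G.degree v)
    (hp : IsGeodesic G x n p) (hq : IsGeodesic G x n q) {i : ℕ} (hi : i + 1 < n)
    (hne : p (i + 1) ≠ q (i + 1)) :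
    T.curvature (T.enclosed T.outer (bigonEdges p q n)) (p (i + 1)) ≤ 1 ∧
    (T.curvature (T.enclosed T.outer (bigonEdges p q n)) (p (i + 1)) ≤ 0 ∨
      ∃ w, IsGeodesic G x n (Function.update p (i + 1) w) ∧
        T.enclosed T.outer (bigonEdges (Function.update p (i + 1) w) q n) ⊂
          T.enclosed T.outer (bigonEdges p q n)) := by
  rcases curvature_cases hdeg
    (fun d hd h => snd_of_mem_bigonEdges_inner hp hq hi hne hd h) with
    h | ⟨-, h, -⟩ | ⟨h, w, h1, h2, h3, ⟨d, hd, h4, h5⟩, h6⟩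
  · exact ⟨by omega, Or.inl h⟩
  -- A single triangle would make `p i` and `p (i + 2)` adjacent, but their distances from `x`
  -- differ by `2`.
  · have := dist_le_succ_of_adj T.isPlanar.1 x h
    rw [hp.dist _ (by omega), hp.dist _ (by omega)] at this
    omega
  · refine ⟨h, Or.inr ⟨w, hp.update T.isPlanar.1 hi h1 h2, ?_⟩⟩
    have hp' := hp.update T.isPlanar.1 hi h1 h2
    refine RotationSystem.enclosed_ssubset ?_ h4 h5 ?_
    · rintro e (⟨j, hj, he⟩ | ⟨j, hj, he⟩ | he)
      · by_cases hj1 : j = i + 1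
        · subst hj1
          rw [Function.update_self, Function.update_of_ne (by omega)] at he
          exact Or.inr (h6 e (Or.inr he))
        · rw [Function.update_of_ne hj1] at he
          by_cases hj2 : j = i
          · subst hj2
            rw [Function.update_self] at he
            exact Or.inr (h6 e (Or.inl he))
          · rw [Function.update_of_ne (by omega)] at he
            exact Or.inl (Or.inl ⟨j, hj, he⟩)
      · exact Or.inl (Or.inr (Or.inl ⟨j, hj, he⟩))
      · rw [Function.update_of_ne (by omega)] at he
        exact Or.inl (Or.inr (Or.inr he))
    -- The boundary edge at `p (i + 1)` is dropped, since that vertex lies on neither side of the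
    -- new bigon; this makes the inclusion strict.
    · intro h
      have hP : ∀ j ≤ n, p (i + 1) ≠ Function.update p (i + 1) w j := by
        intro j hj h7
        obtain rfl := hp.inj hp' (by omega) hj h7
        rw [Function.update_self] at h7
        exact h3.ne h7
      have hQ : ∀ j ≤ n, p (i + 1) ≠ q j := by
        intro j hj h7
        obtain rfl := hp.inj hq (by omega) hj h7
        exact hne h7
      rcases snd_of_mem_bigonEdges h with ⟨j, hj, h7, -⟩ | ⟨j, hj, h7, -⟩ | ⟨j, hj, h7, -⟩ |
        ⟨j, hj, h7, -⟩ | ⟨h7, -⟩ | ⟨h7, -⟩ <;> rw [hd] at h7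
      · exact hP _ hj.le h7
      · exact hP _ hj h7
      · exact hQ _ hj.le h7
      · exact hQ _ hj h7
      · exact hP _ le_rfl h7
      · exact hQ _ le_rfl h7

end BigonCurvature
-- Spheres around a vertex, and the descent
section Metric

variable {V : Type*} [Fintype V] {G : SimpleGraph V} [DecidableRel G.Adj]
  {T : DiscTriangulation G}

lemma curvature_le_two_of_at_most_two (hdeg : ∀ v : V, T.IsInternal v → 6 ≤ G.degree v)
    {Z : Set (Sym2 V)} {v a b : V}
    (hZ : ∀ d : G.Dart, d.fst = v → d.edge ∈ Z → d.snd = a ∨ d.snd = b) :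
    T.curvature (T.enclosed T.outer Z) v ≤ 2 := by
  rcases curvature_cases hdeg hZ with h | ⟨h, -⟩ | ⟨h, -⟩ <;> omega

/-- A bigon over an edge whose sides are nowhere convex has a single triangle at its top. -/
lemma exists_corner_of_bigon (hdeg : ∀ v : V, T.IsInternal v → 6 ≤ G.degree v)
    {x : V} {m : ℕ} {p q : ℕ → V} (hp : IsGeodesic G x (m + 1) p) (hq : IsGeodesic G x (m + 1) q)
    (htop : G.Adj (p (m + 1)) (q (m + 1))) (hne : p 1 ≠ q 1)
    (hpi : ∀ i, i + 1 < m + 1 →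
      T.curvature (T.enclosed T.outer (bigonEdges p q (m + 1))) (p (i + 1)) ≤ 0)
    (hqi : ∀ i, i + 1 < m + 1 →
      T.curvature (T.enclosed T.outer (bigonEdges p q (m + 1))) (q (i + 1)) ≤ 0) :
    G.Adj (p m) (q (m + 1)) ∧ ∃ d : G.Dart, d.fst = p (m + 1) ∧ T.face d ≠ T.outer ∧
      s(d.snd, (T.rot.symm d).snd) = s(p m, q (m + 1)) := by
  have hsum := six_le_sum_curvature_bigon (T := T) hp hq (Or.inr htop) m.succ_pos hne
  have hx := curvature_le_two_of_at_most_two hdeg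
    (fun d hd h => snd_of_mem_bigonEdges_base hp hq m.succ_pos hd h)
  have hqn : T.curvature (T.enclosed T.outer (bigonEdges p q (m + 1))) (q (m + 1)) ≤ 2 :=
    curvature_le_two_of_at_most_two hdeg (a := q m) (b := p (m + 1)) fun d hd h =>
      snd_of_mem_bigonEdges_end hq hp htop.ne' hd (by rwa [bigonEdges_comm])
  have hcases := curvature_cases hdeg
    (fun d hd h => snd_of_mem_bigonEdges_end hp hq htop.ne hd h)
  set κ := T.curvature (T.enclosed T.outer (bigonEdges p q (m + 1))) with hκ
  by_contra hcon
  have hpn : κ (p (m + 1)) ≤ 1 := by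
    rcases hcases with h | ⟨-, h⟩ | ⟨h, -⟩
    · omega
    · exact absurd h hcon
    · exact h
  -- If the corner at `p (m + 1)` is not a single triangle, the total is at most `2 + 1 + 2 = 5 <
  -- 6`.
  have hbound : ∀ v, κ v ≤ (if v = x then 2 else 0) + (if v = p (m + 1) then 1 else 0)
      + (if v = q (m + 1) then 2 else 0) := by
    intro v
    by_cases h1 : v = x
    · subst h1
      rw [if_pos rfl]
      split_ifs <;> omega
    by_cases h2 : v = p (m + 1)
    · subst h2
      rw [if_pos rfl]
      split_ifs <;> omega
    by_cases h3 : v = q (m + 1)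
    · subst h3
      rw [if_pos rfl]
      split_ifs <;> omega
    rw [if_neg h1, if_neg h2, if_neg h3]
    by_cases h4 : ∃ i ≤ m + 1, v = p i
    · obtain ⟨i, hi, rfl⟩ := h4
      rcases i with _ | i
      · exact absurd hp.zero h1
      · have : i ≠ m := fun h => h2 (h ▸ rfl)
        exact hpi i (by omega)
    by_cases h5 : ∃ i ≤ m + 1, v = q i
    · obtain ⟨i, hi, rfl⟩ := h5
      rcases i with _ | i
      · exact absurd hq.zero h1
      · have : i ≠ m := fun h => h3 (h ▸ rfl)
        exact hqi i (by omega)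
    push Not at h4 h5
    exact curvature_nonpos_of_off hdeg h4 h5
  have := hsum.trans (Finset.sum_le_sum fun v _ => hbound v)
  simp [Finset.sum_add_distrib] at this

/-- Every triangle of the graph is an internal face. -/
lemma exists_corner_of_triangle (hdeg : ∀ v : V, T.IsInternal v → 6 ≤ G.degree v)
    {a b c : V} (hab : G.Adj a b) (hac : G.Adj a c) (hbc : G.Adj b c) :
    ∃ d : G.Dart, d.fst = a ∧ T.face d ≠ T.outer ∧ s(d.snd, (T.rot.symm d).snd) = s(b, c) := by
  have hgeo : ∀ {y : V}, G.Adj b y → IsGeodesic G b (0 + 1) (fun i => if i = 0 then b else y) := by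
    intro y hy
    refine ⟨rfl, fun i hi => ?_, fun i hi => ?_⟩
    · obtain rfl : i = 0 := by omega
      exact hy
    · interval_cases i
      · simp
      · simpa using hy
  -- A 3-cycle is a bigon of length `1` based at `b`; its sides have no inner vertices.
  exact (exists_corner_of_bigon hdeg (hgeo hab.symm) (hgeo hbc) hac hac.ne
    (fun i hi => by omega) (fun i hi => by omega)).2

/-- The three triangles at `u` are internal faces, so `r`, `v`, `w` are pairwise consecutive around
`u`. They therefore exhaust the rotation, and `u` is an internal vertex of degree at most `3`. -/
lemma no_complete_four (hdeg : ∀ v : V, T.IsInternal v → 6 ≤ G.degree v)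
    {r u v w : V} (hur : G.Adj u r) (huv : G.Adj u v) (huw : G.Adj u w) (hvw : G.Adj v w)
    (hrv : G.Adj r v) (hrw : G.Adj r w) : False := by
  have key : ∀ {b c : V}, (hb : G.Adj u b) → (hc : G.Adj u c) → G.Adj b c →
      (T.rot ⟨(u, b), hb⟩ = ⟨(u, c), hc⟩ ∧ T.face ⟨(u, c), hc⟩ ≠ T.outer) ∨
      (T.rot ⟨(u, c), hc⟩ = ⟨(u, b), hb⟩ ∧ T.face ⟨(u, b), hb⟩ ≠ T.outer) := by
    intro b c hb hc hbc
    obtain ⟨d, hd, ho, hs⟩ := exists_corner_of_triangle hdeg hb hc hbc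
    have hd' := (T.fst_rot_symm d).trans hd
    have hdart : ∀ (e : G.Dart) {y : V} (hy : G.Adj u y), e.fst = u → e.snd = y →
        e = ⟨(u, y), hy⟩ := fun e y hy h1 h2 => SimpleGraph.Dart.ext _ _ (Prod.ext h1 h2)
    rcases Sym2.eq_iff.1 hs with ⟨h1, h2⟩ | ⟨h1, h2⟩
    · right
      rw [← hdart _ hb hd h1, ← hdart _ hc hd' h2]
      exact ⟨T.rot.apply_symm_apply d, ho⟩
    · left
      rw [← hdart _ hc hd h1, ← hdart _ hb hd' h2]
      exact ⟨T.rot.apply_symm_apply d, ho⟩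
  have hne : ∀ {b c : V} (hb : G.Adj u b) (hc : G.Adj u c), b ≠ c →
      (⟨(u, b), hb⟩ : G.Dart) ≠ ⟨(u, c), hc⟩ := by
    intro b c hb hc h h'
    exact h (congrArg (fun d : G.Dart => d.snd) h')
  have k1 := key huv huw hvw
  have k2 := key hur huv hrv
  have k3 := key hur huw hrw
  have n1 := hne huv huw hvw.ne
  have n2 := hne hur huv hrv.ne
  have n3 := hne hur huw hrw.ne
  set α : G.Dart := ⟨(u, r), hur⟩
  set β : G.Dart := ⟨(u, v), huv⟩
  set γ : G.Dart := ⟨(u, w), huw⟩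
  have hcyc : ∀ e : G.Dart, e = α ∨ e = β ∨ e = γ →
      (T.rot e = α ∨ T.rot e = β ∨ T.rot e = γ) ∧ T.face e ≠ T.outer := by
    have hi : ∀ {a b c : G.Dart}, T.rot a = c → T.rot b = c → a = b := fun h h' =>
      T.rot.injective (h.trans h'.symm)
    rcases k1 with ⟨k1, o1⟩ | ⟨k1, o1⟩ <;> rcases k2 with ⟨k2, o2⟩ | ⟨k2, o2⟩ <;>
      rcases k3 with ⟨k3, o3⟩ | ⟨k3, o3⟩
    -- Of the eight combinations of directions only the two cyclic ones survive; in the others two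
    -- distinct darts share an image or a preimage under `rot`.
    all_goals first
      | (rintro e (rfl | rfl | rfl) <;> refine ⟨?_, by assumption⟩ <;> simp [*])
      | exact absurd (k2.symm.trans k3) n1
      | exact absurd (k3.symm.trans k2) n1
      | exact absurd (hi k2 k3) n1
      | exact absurd (hi k3 k2) n1
      | exact absurd (hi k3 k1) n2
      | exact absurd (hi k2 k1) n3
  have hall : ∀ e : G.Dart, e.fst = u → e = α ∨ e = β ∨ e = γ := fun e he =>
    T.rot_induction (P := fun e => e = α ∨ e = β ∨ e = γ) (d := α)
      (fun a _ ha => (hcyc a ha).1) he.symm (Or.inl rfl)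
  have h6 := hdeg u fun d hd hdu => (hcyc d (hall d hdu)).2 (T.mem_faceDarts.1 hd)
  rw [← G.dart_fst_fiber_card_eq_degree] at h6
  have h3 : (Finset.univ.filter fun d : G.Dart => d.fst = u) ⊆ {α, β, γ} := by
    intro d hd
    simpa using hall d (by simpa using hd)
  have := (Finset.card_le_card h3).trans Finset.card_le_three
  omega

/-- The ends of an edge on a sphere have a common neighbour closer to the centre. -/
lemma exists_common_lower_neighbor (hdeg : ∀ v : V, T.IsInternal v → 6 ≤ G.degree v) (n : ℕ) :
    ∀ x u v : V, G.Adj u v → G.dist x u = n → G.dist x v = n →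
      ∃ w, G.Adj w u ∧ G.Adj w v ∧ G.dist x w + 1 = n := by
  have hG := T.isPlanar.1
  induction n using Nat.strong_induction_on with
  | _ n ih =>
  intro x u v huv hxu hxv
  rcases n with _ | m
  · rw [hG.dist_eq_zero_iff] at hxu hxv
    exact absurd (hxu.symm.trans hxv) huv.ne
  -- The inner induction, on the number of enclosed faces, replaces the choice of a minimal bigon.
  have main : ∀ k p q, IsGeodesic G x (m + 1) p → IsGeodesic G x (m + 1) q → p (m + 1) = u →
      q (m + 1) = v → (T.enclosed T.outer (bigonEdges p q (m + 1))).card = k →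
      ∃ w, G.Adj w u ∧ G.Adj w v ∧ G.dist x w + 1 = m + 1 := by
    intro k
    induction k using Nat.strong_induction_on with
    | _ k ihk =>
    intro p q hp hq hpu hqv hk
    -- If the sides meet midway, the meeting point serves as a new centre at smaller distance.
    by_cases hj : ∃ j, 0 < j ∧ j < m + 1 ∧ p j = q j
    · obtain ⟨j, hj0, hjn, hpq⟩ := hj
      have h1 := hp.dist_to_end hG hjn.le
      have h2 := hq.dist_to_end hG hjn.le
      rw [hpu] at h1
      rw [hqv, ← hpq] at h2
      obtain ⟨w, hwu, hwv, hw⟩ := ih (m + 1 - j) (by omega) (p j) u v huv h1 h2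
      refine ⟨w, hwu, hwv, ?_⟩
      have h3 := hG.dist_triangle (u := x) (v := p j) (w := w)
      rw [hp.dist j hjn.le] at h3
      have h4 := dist_le_succ_of_adj hG x hwu
      omega
    push Not at hj
    by_contra hcon
    have hpi : ∀ i, i + 1 < m + 1 →
        T.curvature (T.enclosed T.outer (bigonEdges p q (m + 1))) (p (i + 1)) ≤ 0 := by
      intro i hi
      rcases (curvature_inner hdeg hp hq hi (hj _ i.succ_pos hi)).2 with h | ⟨w, hp', hlt⟩
      · exact h
      · exact absurd (ihk _ (hk ▸ Finset.card_lt_card hlt) _ _ hp' hq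
          (by rw [Function.update_of_ne (by omega), hpu]) hqv rfl) hcon
    have hqi : ∀ i, i + 1 < m + 1 →
        T.curvature (T.enclosed T.outer (bigonEdges p q (m + 1))) (q (i + 1)) ≤ 0 := by
      intro i hi
      have := (curvature_inner (T := T) hdeg hq hp hi (hj _ i.succ_pos hi).symm).2
      rw [bigonEdges_comm q p] at this
      rcases this with h | ⟨w, hq', hlt⟩
      · exact h
      · rw [bigonEdges_comm] at hlt
        exact absurd (ihk _ (hk ▸ Finset.card_lt_card hlt) _ _ hp hq' hpu
          (by rw [Function.update_of_ne (by omega), hqv]) rfl) hcon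
    have hne : p 1 ≠ q 1 := by
      rcases m with _ | m
      · simp only [zero_add] at hpu hqv
        rw [hpu, hqv]
        exact huv.ne
      · exact hj 1 one_pos (by omega)
    have h := (exists_corner_of_bigon hdeg hp hq (by rwa [hpu, hqv]) hne hpi hqi).1
    have h' := hp.adj m m.lt_succ_self
    rw [hqv] at h
    rw [hpu] at h'
    exact hcon ⟨p m, h', h, by rw [hp.dist m m.le_succ]⟩
  obtain ⟨p, hp, hpu⟩ := exists_isGeodesic hG hxu
  obtain ⟨q, hq, hqv⟩ := exists_isGeodesic hG hxv
  exact main _ p q hp hq hpu hqv rfl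

/-- Two neighbours of a vertex that are closer to the centre are adjacent. -/
lemma adj_of_lower_neighbors (hdeg : ∀ v : V, T.IsInternal v → 6 ≤ G.degree v) (n : ℕ) :
    ∀ x u a b : V, G.Adj a u → G.Adj b u → G.dist x a = n → G.dist x b = n →
      G.dist x u = n + 1 → a ≠ b → G.Adj a b := by
  have hG := T.isPlanar.1
  induction n using Nat.strong_induction_on with
  | _ n ih =>
  intro x u a b hau hbu hxa hxb hxu hab
  rcases n with _ | m
  · rw [hG.dist_eq_zero_iff] at hxa hxb
    exact absurd (hxa.symm.trans hxb) hab
  have extend : ∀ {c : V}, G.Adj c u → G.dist x c = m + 1 →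
      ∃ p, IsGeodesic G x (m + 1 + 1) p ∧ p (m + 1) = c ∧ p (m + 1 + 1) = u := by
    intro c hcu hc
    obtain ⟨p, hp, hpc⟩ := exists_isGeodesic hG hc
    refine ⟨Function.update p (m + 1 + 1) u, ⟨?_, fun i hi => ?_, fun i hi => ?_⟩, ?_, by simp⟩
    · rw [Function.update_of_ne (by omega), hp.zero]
    · rw [Function.update_of_ne (by omega)]
      rcases Nat.lt_succ_iff_lt_or_eq.1 hi with hi | rfl
      · rw [Function.update_of_ne (by omega)]
        exact hp.adj i hi
      · rw [Function.update_self, hpc]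
        exact hcu
    · rcases Nat.le_succ_iff.1 hi with hi | rfl
      · rw [Function.update_of_ne (by omega)]
        exact hp.dist i hi
      · rw [Function.update_self, hxu]
    · rw [Function.update_of_ne (by omega), hpc]
  have main : ∀ k p q, IsGeodesic G x (m + 1 + 1) p → IsGeodesic G x (m + 1 + 1) q →
      p (m + 1) = a → q (m + 1) = b → p (m + 1 + 1) = u → q (m + 1 + 1) = u →
      (T.enclosed T.outer (bigonEdges p q (m + 1 + 1))).card = k → G.Adj a b := by
    intro k
    induction k using Nat.strong_induction_on with
    | _ k ihk =>
    intro p q hp hq hpa hqb hpu hqu hk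
    by_cases hj : ∃ j, 0 < j ∧ j < m + 1 ∧ p j = q j
    · obtain ⟨j, hj0, hjn, hpq⟩ := hj
      have h1 := hp.dist_to_end hG (j := j) (by omega)
      rw [hpu] at h1
      have near : ∀ {c : V}, G.Adj c u → G.dist x c = m + 1 → ∀ r, IsGeodesic G x (m + 1) r →
          r (m + 1) = c → r j = p j → G.dist (p j) c = m + 1 - j := by
        intro c _ _ r hr hrc hrj
        rw [← hrj, ← hrc]
        exact hr.dist_to_end hG hjn.le
      have trunc : ∀ {r : ℕ → V}, IsGeodesic G x (m + 1 + 1) r → IsGeodesic G x (m + 1) r :=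
        fun hr => ⟨hr.zero, fun i hi => hr.adj i (by omega), fun i hi => hr.dist i (by omega)⟩
      exact ih (m + 1 - j) (by omega) (p j) u a b hau hbu
        (near hau hxa p (trunc hp) hpa rfl) (near hbu hxb q (trunc hq) hqb hpq.symm)
        (by omega) hab
    push Not at hj
    have hj' : ∀ j, 0 < j → j < m + 1 + 1 → p j ≠ q j := by
      intro j h0 h1
      rcases Nat.lt_succ_iff_lt_or_eq.1 h1 with h1 | rfl
      · exact hj j h0 h1
      · rwa [hpa, hqb]
    by_contra hcon
    -- Pushing is used only below index `m + 1`, since `a` and `b` must stay on the sides; these two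
    -- contribute at most `1` each.
    have hpi : ∀ i, i + 1 < m + 1 →
        T.curvature (T.enclosed T.outer (bigonEdges p q (m + 1 + 1))) (p (i + 1)) ≤ 0 := by
      intro i hi
      rcases (curvature_inner hdeg hp hq (i := i) (by omega) (hj _ i.succ_pos hi)).2 with
        h | ⟨w, hp', hlt⟩
      · exact h
      · exact absurd (ihk _ (hk ▸ Finset.card_lt_card hlt) _ _ hp' hq
          (by rw [Function.update_of_ne (by omega), hpa]) hqb
          (by rw [Function.update_of_ne (by omega), hpu]) hqu rfl) hcon
    have hqi : ∀ i, i + 1 < m + 1 →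
        T.curvature (T.enclosed T.outer (bigonEdges p q (m + 1 + 1))) (q (i + 1)) ≤ 0 := by
      intro i hi
      have := (curvature_inner (T := T) hdeg hq hp (i := i) (by omega)
        (hj _ i.succ_pos hi).symm).2
      rw [bigonEdges_comm q p] at this
      rcases this with h | ⟨w, hq', hlt⟩
      · exact h
      · rw [bigonEdges_comm] at hlt
        exact absurd (ihk _ (hk ▸ Finset.card_lt_card hlt) _ _ hp hq' hpa
          (by rw [Function.update_of_ne (by omega), hqb]) hpu
          (by rw [Function.update_of_ne (by omega), hqu]) rfl) hcon
    have hpm := (curvature_inner (T := T) hdeg hp hq (i := m) (by omega)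
      (hj' _ m.succ_pos (by omega))).1
    have hqm := (curvature_inner (T := T) hdeg hq hp (i := m) (by omega)
      (hj' _ m.succ_pos (by omega)).symm).1
    rw [bigonEdges_comm q p] at hqm
    have htop : p (m + 1 + 1) = q (m + 1 + 1) := hpu.trans hqu.symm
    have hsum := six_le_sum_curvature_bigon (T := T) hp hq (Or.inl htop) (by omega)
      (hj' 1 one_pos (by omega))
    have hx := curvature_le_two_of_at_most_two hdeg
      (fun d hd h => snd_of_mem_bigonEdges_base hp hq (by omega) hd h)
    have hcases := curvature_cases hdeg
      (fun d hd h => snd_of_mem_bigonEdges_common_end hp hq htop hd h)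
    rw [hpa, hqb] at hcases
    set κ := T.curvature (T.enclosed T.outer (bigonEdges p q (m + 1 + 1))) with hκ
    have hpn : κ (p (m + 1 + 1)) ≤ 1 := by
      rcases hcases with h | ⟨-, h, -⟩ | ⟨h, -⟩
      · omega
      · exact absurd h hcon
      · exact h
    -- If `a` and `b` are not adjacent, the corner at `u` has at most `1`, and the total is at most
    -- `2 + 1 + 1 + 1 = 5 < 6`.
    have hbound : ∀ v, κ v ≤ (if v = x then 2 else 0) + (if v = p (m + 1) then 1 else 0)
        + (if v = q (m + 1) then 1 else 0) + (if v = p (m + 1 + 1) then 1 else 0) := by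
      intro v
      by_cases h1 : v = x
      · subst h1
        rw [if_pos rfl]
        split_ifs <;> omega
      by_cases h2 : v = p (m + 1)
      · subst h2
        rw [if_pos rfl]
        split_ifs <;> omega
      by_cases h3 : v = q (m + 1)
      · subst h3
        rw [if_pos rfl]
        split_ifs <;> omega
      by_cases h4 : v = p (m + 1 + 1)
      · subst h4
        rw [if_pos rfl]
        split_ifs <;> omega
      rw [if_neg h1, if_neg h2, if_neg h3, if_neg h4]
      by_cases h5 : ∃ i ≤ m + 1 + 1, v = p i
      · obtain ⟨i, hi, rfl⟩ := h5
        rcases i with _ | i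
        · exact absurd hp.zero h1
        · have : i ≠ m := fun h => h2 (h ▸ rfl)
          have : i ≠ m + 1 := fun h => h4 (h ▸ rfl)
          exact hpi i (by omega)
      by_cases h6 : ∃ i ≤ m + 1 + 1, v = q i
      · obtain ⟨i, hi, rfl⟩ := h6
        rcases i with _ | i
        · exact absurd hq.zero h1
        · have : i ≠ m := fun h => h3 (h ▸ rfl)
          have : i ≠ m + 1 := fun h => h4 (h ▸ htop.symm)
          exact hqi i (by omega)
      push Not at h5 h6
      exact curvature_nonpos_of_off hdeg h5 h6
    have := hsum.trans (Finset.sum_le_sum fun v _ => hbound v)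
    simp [Finset.sum_add_distrib] at this
  obtain ⟨p, hp, hpa, hpu⟩ := extend hau hxa
  obtain ⟨q, hq, hqb, hqu⟩ := extend hbu hxb
  exact main _ p q hp hq hpa hqb hpu hqu rfl

lemma no_equidistant_triangle (hdeg : ∀ v : V, T.IsInternal v → 6 ≤ G.degree v) (x : V) (n : ℕ) :
    ∀ a b c : V, G.Adj a b → G.Adj b c → G.Adj a c →
      ¬ (G.dist x a = n ∧ G.dist x b = n ∧ G.dist x c = n) := by
  induction n with
  | zero =>
    rintro a b c hab - - ⟨ha, hb, -⟩
    rw [T.isPlanar.1.dist_eq_zero_iff] at ha hb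
    exact hab.ne (ha.symm.trans hb)
  | succ n ih =>
    rintro a b c hab hbc hac ⟨ha, hb, hc⟩
    obtain ⟨r, hra, hrb, hr⟩ := exists_common_lower_neighbor hdeg _ x a b hab ha hb
    obtain ⟨s, hsb, hsc, hs⟩ := exists_common_lower_neighbor hdeg _ x b c hbc hb hc
    obtain ⟨t, hta, htc, ht⟩ := exists_common_lower_neighbor hdeg _ x a c hac ha hc
    have hr' : G.dist x r = n := by omega
    have hs' : G.dist x s = n := by omega
    have ht' : G.dist x t = n := by omega
    -- A lower neighbour shared by two sides would be adjacent to all of `a`, `b`, `c`, giving a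
    -- `K₄`.
    by_cases hrs : r = s
    · subst hrs
      exact no_complete_four hdeg hra.symm hab hac hbc hrb hsc
    by_cases hst : s = t
    · subst hst
      exact no_complete_four hdeg hta.symm hab hac hbc hsb hsc
    by_cases hrt : r = t
    · subst hrt
      exact no_complete_four hdeg hra.symm hab hac hbc hrb htc
    exact ih r s t (adj_of_lower_neighbors hdeg n x b r s hrb hsb hr' hs' hb hrs)
      (adj_of_lower_neighbors hdeg n x c s t hsc htc hs' ht' hc hst)
      (adj_of_lower_neighbors hdeg n x a r t hra hta hr' ht' ha hrt) ⟨hr', hs', ht'⟩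

end Metric
end DiscTriangulation

theorem mainTheorem3 {V : Type*} [Fintype V] (G : SimpleGraph V) [DecidableRel G.Adj]
    (T : DiscTriangulation G)
    (hdeg : ∀ v : V, T.IsInternal v → 6 ≤ G.degree v)
    (a b c : V) (hab : G.Adj a b) (hbc : G.Adj b c) (hac : G.Adj a c)
    (x : V) :
    ¬ (G.dist x a = G.dist x b ∧ G.dist x b = G.dist x c) := by
  rintro ⟨h1, h2⟩
  exact T.no_equidistant_triangle hdeg x (G.dist x c) a b c hab hbc hac ⟨h1.trans h2, h2, rfl⟩
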